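/- The $h$-index of a finite graph is the largest number $\ell$ such that the graph has at least $\ell$ vertices of degree at least $\ell$; the diameter of a connected graph is the length of a longest shortest path in it. There is an algorithm on the word RAM (words of $O(\log(n+m))$ bits, constant time for each elementary operation) which, given a finite, connected, undirected, unweighted, simple graph $G$ with $n\ge 1$ vertices and $m$ edges by its adjacency lists, computes the diameter of $G$ and runs in $$O\bigl(h\cdot(m+n) + n\cdot d\cdot 2^{\,h\log_2 d + d\log_2 h}\bigr)$$ time, where $d$ is the diameter and $h$ is the $h$-index of $G$; neither $d$ nor $h$ is part of the input. (For $n=1$, where $d=h=0$, the expression in the $O$ is read as $1$.) -/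

import Mathlib

/-!  Word RAM with structured control flow.  A program is a fixed finite object that uses finitely
many registers, and a memory of words addressed by register contents.  Every register operation,
memory access and test takes one step.  On words of `w` bits, sums and products are modulo `2 ^ w`. -/

namespace WordRAM

/-- The contents of the registers and of the memory. -/
structure State where
  reg : ℕ → ℕ
  mem : ℕ → ℕ

/-- Write `x` into register `i`. -/
def State.setReg (s : State) (i x : ℕ) : State :=
  { s with reg := Function.update s.reg i x }

/-- Write `x` into the memory cell with address `a`. -/
def State.setMem (s : State) (a x : ℕ) : State :=
  { s with mem := Function.update s.mem a x }

/-- Basic instructions; all arguments except the `c` of `const` are names of registers. -/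
inductive Instr where
  /-- `reg i := c` -/
  | const (i c : ℕ)
  /-- `reg i := reg j` -/
  | move (i j : ℕ)
  /-- `reg i := reg j + reg l` -/
  | add (i j l : ℕ)
  /-- `reg i := max (reg j - reg l) 0` -/
  | sub (i j l : ℕ)
  /-- `reg i := reg j * reg l` -/
  | mul (i j l : ℕ)
  /-- `reg i := mem (reg j)` -/
  | load (i j : ℕ)
  /-- `mem (reg i) := reg j` -/
  | store (i j : ℕ)

/-- The effect of an instruction on a machine whose words have `w` bits. -/
def Instr.run (w : ℕ) : Instr → State → State
  | .const i c, s => s.setReg i (c % 2 ^ w)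
  | .move i j, s => s.setReg i (s.reg j)
  | .add i j l, s => s.setReg i ((s.reg j + s.reg l) % 2 ^ w)
  | .sub i j l, s => s.setReg i (s.reg j - s.reg l)
  | .mul i j l, s => s.setReg i ((s.reg j * s.reg l) % 2 ^ w)
  | .load i j, s => s.setReg i (s.mem (s.reg j))
  | .store i j, s => s.setMem (s.reg i) (s.reg j)

/-- Tests that compare two registers. -/
inductive Test where
  /-- `reg i = reg j` -/
  | eq (i j : ℕ)
  /-- `reg i < reg j` -/
  | lt (i j : ℕ)

/-- The test succeeds in the given state. -/
def Test.Holds : Test → State → Prop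
  | .eq i j, s => s.reg i = s.reg j
  | .lt i j, s => s.reg i < s.reg j

/-- Programs. -/
inductive Prog where
  | skip
  | instr (a : Instr)
  | seq (p q : Prog)
  | ite (b : Test) (p q : Prog)
  | while (b : Test) (p : Prog)

/-- `Exec w p s s' t`: on `w`-bit words, the program `p` started in state `s` halts in state `s'`
after exactly `t` steps. -/
inductive Exec (w : ℕ) : Prog → State → State → ℕ → Prop where
  | skip (s : State) : Exec w .skip s s 1
  | instr (a : Instr) (s : State) : Exec w (.instr a) s (a.run w s) 1
  | seq {p q : Prog} {s s' s'' : State} {t t' : ℕ} :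
      Exec w p s s' t → Exec w q s' s'' t' → Exec w (.seq p q) s s'' (t + t')
  | ite_true {b : Test} {p q : Prog} {s s' : State} {t : ℕ} :
      b.Holds s → Exec w p s s' t → Exec w (.ite b p q) s s' (t + 1)
  | ite_false {b : Test} {p q : Prog} {s s' : State} {t : ℕ} :
      ¬ b.Holds s → Exec w q s s' t → Exec w (.ite b p q) s s' (t + 1)
  | while_false {b : Test} {p : Prog} {s : State} :
      ¬ b.Holds s → Exec w (.while b p) s s 1
  | while_true {b : Test} {p : Prog} {s s' s'' : State} {t t' : ℕ} :
      b.Holds s → Exec w p s s' t → Exec w (.while b p) s' s'' t' →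
        Exec w (.while b p) s s'' (t + t' + 1)

/-- The initial state: the input stands in the memory cells `0, 1, 2, …`; all other cells and all
registers contain `0`. -/
def initState (x : List ℕ) : State where
  reg := fun _ => 0
  mem := fun a => x.getD a 0

end WordRAM

/-- `adj` is an adjacency-list representation of `G`: the list of `v` contains every neighbour of
`v` exactly once and no other vertex, in an arbitrary order. -/
def IsAdjList {n : ℕ} (G : SimpleGraph (Fin n)) (adj : Fin n → List (Fin n)) : Prop :=
  ∀ v, (adj v).Nodup ∧ ∀ u, u ∈ adj v ↔ G.Adj v u

/-- The input string of an adjacency-list representation: the number of vertices, followed by the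
adjacency lists of the vertices `0, 1, …, n - 1`, each preceded by its length. -/
def encodeAdjList {n : ℕ} (adj : Fin n → List (Fin n)) : List ℕ :=
  n :: (List.finRange n).flatMap fun v => (adj v).length :: (adj v).map Fin.val

/-- The h-index of a graph: the largest `l` such that at least `l` vertices have degree at
least `l`. -/
noncomputable def SimpleGraph.hIndex {V : Type*} [Fintype V] (G : SimpleGraph V)
    [DecidableRel G.Adj] : ℕ :=
  sSup {l : ℕ | l ≤ (Finset.univ.filter fun v => l ≤ G.degree v).card}

/-- The supremum in the definition of the h-index is a maximum. -/
theorem SimpleGraph.isGreatest_hIndex {V : Type*} [Fintype V] (G : SimpleGraph V)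
    [DecidableRel G.Adj] :
    IsGreatest {l : ℕ | l ≤ (Finset.univ.filter fun v => l ≤ G.degree v).card} G.hIndex := by
  have hb : BddAbove {l : ℕ | l ≤ (Finset.univ.filter fun v => l ≤ G.degree v).card} :=
    ⟨Fintype.card V, fun l hl => le_trans hl (Finset.card_le_univ _)⟩
  exact ⟨Nat.sSup_mem ⟨0, Nat.zero_le _⟩ hb, fun l hl => le_csSup hb hl⟩

/-! Let `H` be the set of vertices of degree more than the h-index `h`; by maximality of `h` it has
at most `h` elements. A breadth-first search from each vertex of `H` costs `O(h (m + n))` in total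
and yields all distances to `H`. Two vertices have the same type if they have the same distances to
all of `H`. Outside `H` these distances lie in `{1, …, d}`, so there are at most `d ^ |H| + |H|`
types (`IsTyping.card_le`).

Whether the eccentricity of `v` is at most `e` is decided as follows. If a shortest path from `v` to
`u` meets `H` in `x`, its length is `d(v, x) + d(x, u)`, which depends only on `v`, `x` and the type
of `u`. If it avoids `H`, then `u` is found by a search from `v` up to depth `e` that does not
expand the vertices of `H`; such a search reaches at most `∑ i ≤ e, h ^ i` vertices
(`BfsRes.mark_of_dist`, `BfsRes.length_le`). So the vertices without a route of length at most `e`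
through `H` are counted type by type, with the sizes of the types as weights, and those of them that
the restricted search reaches are subtracted. The eccentricity is at most `e` if and only if nothing
remains (`BfsRes.test_iff`).

The diameter need not be known: the guess `e` starts at `0`, a failed test raises `e`, and a
successful one passes to the next vertex. This takes `n + d` tests, and `e` never exceeds `d`
(`wp_searchProg`).

A test has no time to clear arrays of length `n`. Every search therefore works in memory that still
contains zeros; fewer than `3 n` groups of three zones of `(n + 1) ^ 2` cells suffice, so addresses
are `O(n ^ 3)` and fit into `O(log n)` bits.

Finally `2 ^ (h log d + d log h) = d ^ h * h ^ d`, and the cost of a test is compared with `d * d ^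
h * h ^ d` (`typeCost_le`). For `d = 1` the factor `d ^ h` absorbs nothing, but then the graph is
complete and `H` is empty (`numGt_eq_zero_of_diam_eq_one`). -/

set_option linter.unusedSimpArgs false

namespace WordRAM

/-! ### Weakest preconditions with elapsed time -/

/-- The program `p`, started in state `s` at time `T`, halts in a state and at a time
that satisfy `Q`. -/
def WP (w : ℕ) (p : Prog) (s : State) (T : ℕ) (Q : State → ℕ → Prop) : Prop :=
  ∃ s' t, Exec w p s s' t ∧ Q s' (T + t)

theorem WP.skip {w : ℕ} {s : State} {T : ℕ} {Q : State → ℕ → Prop} (h : Q s (T + 1)) :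
    WP w .skip s T Q :=
  ⟨s, 1, .skip s, h⟩

theorem WP.seq {w : ℕ} {p q : Prog} {s : State} {T : ℕ} {Q : State → ℕ → Prop}
    (h : WP w p s T fun s' T' => WP w q s' T' Q) : WP w (.seq p q) s T Q := by
  obtain ⟨s', t, he, s'', t', he', hq⟩ := h
  exact ⟨s'', t + t', .seq he he', by rwa [← Nat.add_assoc]⟩

theorem WP.ite {w : ℕ} {b : Test} {p q : Prog} {s : State} {T : ℕ} {Q : State → ℕ → Prop}
    (hp : b.Holds s → WP w p s (T + 1) Q) (hq : ¬ b.Holds s → WP w q s (T + 1) Q) :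
    WP w (.ite b p q) s T Q := by
  by_cases hb : b.Holds s
  · obtain ⟨s', t, he, h⟩ := hp hb
    exact ⟨s', t + 1, .ite_true hb he, by rwa [Nat.add_comm t, ← Nat.add_assoc]⟩
  · obtain ⟨s', t, he, h⟩ := hq hb
    exact ⟨s', t + 1, .ite_false hb he, by rwa [Nat.add_comm t, ← Nat.add_assoc]⟩

/-- Loop rule: `I j s T` is the invariant after `j` iterations, of which there are at most `B`. -/
theorem WP.while {w : ℕ} {b : Test} {p : Prog} {s : State} {T : ℕ} {Q : State → ℕ → Prop}
    (I : ℕ → State → ℕ → Prop) (B : ℕ) (init : I 0 s T)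
    (step : ∀ j s T, I j s T → b.Holds s → j < B ∧ WP w p s (T + 1) (I (j + 1)))
    (post : ∀ j s T, I j s T → ¬ b.Holds s → Q s (T + 1)) :
    WP w (.while b p) s T Q := by
  -- Induction on the number of iterations still allowed; `step` gives `j < B` whenever the test
  -- succeeds, so the same bound yields termination.
  suffices H : ∀ r j s T, I j s T → B - j ≤ r → WP w (.while b p) s T Q from
    H _ 0 s T init le_rfl
  intro r
  induction r with
  | zero =>
    intro j s T hI hr
    have hb : ¬ b.Holds s := fun hb => by have := (step j s T hI hb).1; omega
    exact ⟨s, 1, .while_false hb, post j s T hI hb⟩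
  | succ r ih =>
    intro j s T hI hr
    by_cases hb : b.Holds s
    · obtain ⟨hj, s', t, he, hI'⟩ := step j s T hI hb
      obtain ⟨s'', t', he', hq⟩ := ih (j + 1) s' _ hI' (by omega)
      refine ⟨s'', t + t' + 1, .while_true hb he he', ?_⟩
      convert hq using 1
      omega
    · exact ⟨s, 1, .while_false hb, post j s T hI hb⟩

/-- A straight-line program. -/
def blk : List Instr → Prog
  | [] => .skip
  | a :: l => .seq (.instr a) (blk l)

/-- A precondition of a straight-line program under which no word overflows and `Q` holds at the
end. -/
def Pre (w : ℕ) : List Instr → (State → ℕ → Prop) → State → ℕ → Prop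
  | [], Q, s, T => Q s (T + 1)
  | .const i c :: l, Q, s, T => c < 2 ^ w ∧ Pre w l Q (s.setReg i c) (T + 1)
  | .move i j :: l, Q, s, T => Pre w l Q (s.setReg i (s.reg j)) (T + 1)
  | .add i j k :: l, Q, s, T =>
      s.reg j + s.reg k < 2 ^ w ∧ Pre w l Q (s.setReg i (s.reg j + s.reg k)) (T + 1)
  | .sub i j k :: l, Q, s, T => Pre w l Q (s.setReg i (s.reg j - s.reg k)) (T + 1)
  | .mul i j k :: l, Q, s, T =>
      s.reg j * s.reg k < 2 ^ w ∧ Pre w l Q (s.setReg i (s.reg j * s.reg k)) (T + 1)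
  | .load i j :: l, Q, s, T => Pre w l Q (s.setReg i (s.mem (s.reg j))) (T + 1)
  | .store i j :: l, Q, s, T => Pre w l Q (s.setMem (s.reg i) (s.reg j)) (T + 1)

/-- The side conditions in `Pre` make every reduction modulo `2 ^ w` trivial, so that all later
reasoning about blocks takes place in `ℕ`. -/
theorem WP.blk {w : ℕ} {l : List Instr} {s : State} {T : ℕ} {Q : State → ℕ → Prop}
    (h : Pre w l Q s T) : WP w (blk l) s T Q := by
  induction l generalizing s T with
  | nil => exact WP.skip h
  | cons a l ih =>
    suffices H : Pre w l Q (a.run w s) (T + 1) from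
      WP.seq ⟨_, 1, .instr a s, ih H⟩
    cases a <;> simp only [Pre] at h <;> simp only [Instr.run] <;>
      first
        | exact h
        | (rw [Nat.mod_eq_of_lt h.1]; exact h.2)

/-! ### Adjacency lists in memory -/

/-- The address of the cell with the length of the adjacency list of `v`. -/
def off (A : ℕ → List ℕ) (v : ℕ) : ℕ :=
  1 + ∑ u ∈ Finset.range v, ((A u).length + 1)

theorem off_succ (A : ℕ → List ℕ) (v : ℕ) : off A (v + 1) = off A v + (A v).length + 1 := by
  simp only [off, Finset.sum_range_succ]
  omega

theorem off_mono (A : ℕ → List ℕ) : Monotone (off A) :=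
  monotone_nat_of_le_succ fun v => by rw [off_succ]; omega

/-- The lists `A u`, `u < n`, are lists of numbers below `n` that fit into `U` cells. -/
structure IsInput (n U : ℕ) (A : ℕ → List ℕ) : Prop where
  lt : ∀ u < n, ∀ x ∈ A u, x < n
  nodup : ∀ u < n, (A u).Nodup
  off_le : off A n ≤ U
  lt_U : n < U

theorem IsInput.off_add_le {n U : ℕ} {A : ℕ → List ℕ} (h : IsInput n U A) {u : ℕ} (hu : u < n) :
    off A u + 1 + (A u).length ≤ U := by
  have := off_mono A (Nat.succ_le_of_lt hu)
  have := h.off_le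
  have := off_succ A u
  simp only [Nat.succ_eq_add_one] at *
  omega

/-- The memory `m` contains the adjacency lists and, from address `U` on, their addresses. -/
structure Inp (n U : ℕ) (A : ℕ → List ℕ) (m : ℕ → ℕ) : Prop where
  addr : ∀ v < n, m (U + v) = off A v
  len : ∀ v < n, m (off A v) = (A v).length
  nbr : ∀ v < n, ∀ j, (h : j < (A v).length) → m (off A v + 1 + j) = (A v)[j]

theorem Inp.congr {n U : ℕ} {A : ℕ → List ℕ} {m m' : ℕ → ℕ} (hA : IsInput n U A)
    (h : Inp n U A m) (hm : ∀ a < 2 * U, m' a = m a) : Inp n U A m' := by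
  have hU := hA.lt_U
  refine ⟨fun v hv => ?_, fun v hv => ?_, fun v hv j hj => ?_⟩
  · rw [hm _ (by omega), h.addr v hv]
  · have := hA.off_add_le hv
    rw [hm _ (by omega), h.len v hv]
  · have := hA.off_add_le hv
    rw [hm _ (by omega), h.nbr v hv j hj]

/-! ### Breadth-first search -/

/-- Breadth-first search from `src` up to depth `L` that expands only vertices of degree at most
`thr`.  The mark `D u` is `0` for an unreached vertex `u` and one more than the depth for any
other; `rest` is the queue, `pre` the list of the vertices that have left it, and `β` is the mark
of the vertex that left it last. -/
structure BfsInv (n : ℕ) (A : ℕ → List ℕ) (thr L src : ℕ) (D : ℕ → ℕ) (pre rest : List ℕ)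
    (β : ℕ) : Prop where
  nodup : (pre ++ rest).Nodup
  lt : ∀ u ∈ pre ++ rest, u < n
  mem_iff : ∀ u, D u ≠ 0 ↔ u ∈ pre ++ rest
  sorted : rest.Pairwise fun a b => D a ≤ D b
  low : ∀ u ∈ rest, β ≤ D u
  high : ∀ u ∈ pre ++ rest, D u ≤ β + 1
  src_one : D src = 1
  one : ∀ u, D u = 1 → u = src
  parent : ∀ u i, D u = i + 2 → i < L ∧ ∃ p, D p = i + 1 ∧ (A p).length ≤ thr ∧ u ∈ A p

/-- The neighbours in `l` of `u` are marked, and with at most the mark of `u` plus one. -/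
def Scanned (D : ℕ → ℕ) (u : ℕ) (l : List ℕ) : Prop :=
  ∀ x ∈ l, D x ≠ 0 ∧ D x ≤ D u + 1

/-- The search scans the adjacency lists of these vertices. -/
def Expands (A : ℕ → List ℕ) (thr L : ℕ) (D : ℕ → ℕ) (u : ℕ) : Prop :=
  (A u).length ≤ thr ∧ D u ≤ L

instance (A : ℕ → List ℕ) (thr L : ℕ) (D : ℕ → ℕ) (u : ℕ) : Decidable (Expands A thr L D u) :=
  inferInstanceAs (Decidable (_ ∧ _))

/-- The number of list entries that are scanned when the vertices of `l` are expanded. -/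
def scanCost (A : ℕ → List ℕ) (thr L : ℕ) (D : ℕ → ℕ) (l : List ℕ) : ℕ :=
  (l.map fun u => if Expands A thr L D u then (A u).length else 0).sum

/-- The outcome of the search; `q` is the list of all vertices that were reached. -/
structure BfsRes (n : ℕ) (A : ℕ → List ℕ) (thr L src : ℕ) (D : ℕ → ℕ) (q : List ℕ) : Prop where
  nodup : q.Nodup
  lt : ∀ u ∈ q, u < n
  mem_iff : ∀ u, D u ≠ 0 ↔ u ∈ q
  src_one : D src = 1
  one : ∀ u, D u = 1 → u = src
  parent : ∀ u i, D u = i + 2 → i < L ∧ ∃ p, D p = i + 1 ∧ (A p).length ≤ thr ∧ u ∈ A p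
  closed : ∀ u ∈ q, Expands A thr L D u → Scanned D u (A u)

/-! ### Preservation of the search invariant -/

section

variable {n : ℕ} {A : ℕ → List ℕ} {thr L src : ℕ} {D : ℕ → ℕ} {pre rest : List ℕ} {β u x : ℕ}

theorem length_le_of_nodup {q : List ℕ} (h : q.Nodup) (hlt : ∀ u ∈ q, u < n) : q.length ≤ n := by
  rw [← List.toFinset_card_of_nodup h]
  calc _ ≤ (Finset.range n).card := Finset.card_le_card fun u hu => by
        simpa using hlt u (by simpa using hu)
    _ = n := by simp

theorem BfsInv.init (hs : src < n) :
    BfsInv n A thr L src (Function.update (fun _ => 0) src 1) [] [src] 0 where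
  nodup := by simp
  lt := by simpa using hs
  mem_iff u := by simp [Function.update_apply]
  sorted := by simp
  low := by simp
  high := by simp [Function.update_apply]
  src_one := by simp
  one u hu := by
    by_contra h
    simp [h] at hu
  parent u i hu := by
    by_cases h : u = src <;> simp [h] at hu

/-- The queue is sorted, so the mark of its head is a lower bound for the rest and can replace `β`;
the upper bound survives because `β ≤ D u`. -/
theorem BfsInv.pop (h : BfsInv n A thr L src D pre (u :: rest) β) :
    BfsInv n A thr L src D (pre ++ [u]) rest (D u) where
  nodup := by simpa using h.nodup
  lt := by simpa using h.lt
  mem_iff := by simpa using h.mem_iff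
  sorted := (List.pairwise_cons.1 h.sorted).2
  low := (List.pairwise_cons.1 h.sorted).1
  high x hx := by
    have h1 := h.high x (by simpa using hx)
    have h2 := h.low u (by simp)
    omega
  src_one := h.src_one
  one := h.one
  parent := h.parent

/-- The new vertex receives `D u + 1`, the largest mark that `high` permits, so it may stand at the
end of the sorted queue. Having had mark `0` it was not listed before, and `u` is its parent. -/
theorem BfsInv.visit (h : BfsInv n A thr L src D pre rest (D u)) (hu : u ∈ pre) (hx : D x = 0)
    (hxn : x < n) (hA : x ∈ A u) (he : Expands A thr L D u) :
    BfsInv n A thr L src (Function.update D x (D u + 1)) pre (rest ++ [x]) (D u) := by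
  have hq : x ∉ pre ++ rest := fun hq => (h.mem_iff x).2 hq hx
  have hne : ∀ y ∈ pre ++ rest, y ≠ x := fun y hy e => hq (e ▸ hy)
  have hD : ∀ y ∈ pre ++ rest, Function.update D x (D u + 1) y = D y := fun y hy =>
    Function.update_of_ne (hne y hy) _ _
  have hu0 : D u ≠ 0 := (h.mem_iff u).2 (by simp [hu])
  have hDu := hD u (by simp [hu])
  refine ⟨?_, ?_, ?_, ?_, ?_, ?_, ?_, ?_, ?_⟩
  · rw [← List.append_assoc]
    exact List.Nodup.append h.nodup (by simp) (by simpa using hq)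
  · intro y hy
    rw [← List.append_assoc, List.mem_append] at hy
    rcases hy with hy | hy
    · exact h.lt y hy
    · rw [List.mem_singleton.1 hy]; exact hxn
  · intro y
    rw [← List.append_assoc, List.mem_append, List.mem_singleton, ← h.mem_iff y]
    by_cases e : y = x
    · simp [e]
    · simp [e]
  · refine List.pairwise_append.2 ⟨?_, by simp, ?_⟩
    · refine h.sorted.imp_of_mem fun {a b} ha hb hab => ?_
      rwa [hD a (by simp [ha]), hD b (by simp [hb])]
    · intro a ha b hb
      rw [List.mem_singleton.1 hb, hD a (by simp [ha]), Function.update_self]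
      exact h.high a (by simp [ha])
  · intro y hy
    rcases List.mem_append.1 hy with hy | hy
    · rw [hD y (by simp [hy])]; exact h.low y hy
    · rw [List.mem_singleton.1 hy, Function.update_self]; omega
  · intro y hy
    rw [← List.append_assoc, List.mem_append] at hy
    rcases hy with hy | hy
    · rw [hD y hy]; exact h.high y hy
    · rw [List.mem_singleton.1 hy, Function.update_self]
  · rw [hD src ((h.mem_iff _).1 (by rw [h.src_one]; omega))]
    exact h.src_one
  · intro y hy
    by_cases e : y = x
    · rw [e, Function.update_self] at hy; omega
    · rw [Function.update_of_ne e] at hy; exact h.one y hy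
  · intro y i hy
    by_cases e : y = x
    · rw [e, Function.update_self] at hy
      refine ⟨by have := he.2; omega, u, by rw [hDu]; omega, he.1, e ▸ hA⟩
    · rw [Function.update_of_ne e] at hy
      obtain ⟨hi, p, hp, h1, h2⟩ := h.parent y i hy
      refine ⟨hi, p, ?_, h1, h2⟩
      rw [hD p ((h.mem_iff p).1 (by omega)), hp]

/-- Marks are written only once: the entries of `l` and `u` itself are different from the unmarked
`x`. -/
theorem Scanned.update {l : List ℕ} {b : ℕ} (h : Scanned D u l) (hx : D x = 0) (hu : u ≠ x) :
    Scanned (Function.update D x b) u l := fun y hy => by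
  have := h y hy
  have hyx : y ≠ x := fun e => this.1 (e ▸ hx)
  rwa [Function.update_of_ne hyx, Function.update_of_ne hu]

theorem scanCost_congr {D' : ℕ → ℕ} {l : List ℕ} (h : ∀ u ∈ l, D' u = D u) :
    scanCost A thr L D' l = scanCost A thr L D l := by
  unfold scanCost
  congr 1
  refine List.map_congr_left fun u hu => ?_
  have : Expands A thr L D' u ↔ Expands A thr L D u := by simp [Expands, h u hu]
  simp only [this]

theorem scanCost_append (l l' : List ℕ) :
    scanCost A thr L D (l ++ l') = scanCost A thr L D l + scanCost A thr L D l' := by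
  simp [scanCost]

end

/-- Breadth-first search.  Input registers: `20` source, `21` degree threshold, `22` depth limit,
`23` address of the marks, `24` address of the queue; on exit register `26` contains the address
after the last queue entry. -/
def bfsProg : Prog :=
  .seq (blk [.add 32 23 20, .store 32 2, .store 24 20, .move 25 24, .add 26 24 2])
    (.while (.lt 25 26)
      (.seq (blk [.load 27 25, .add 25 25 2, .add 32 23 27, .load 28 32, .add 32 3 27, .load 29 32,
          .load 30 29])
        (.ite (.lt 21 30) .skip
          (.ite (.lt 22 28) .skip
            (.seq (blk [.add 29 29 2, .add 30 29 30])
              (.while (.lt 29 30)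
                (.seq (blk [.load 31 29, .add 29 29 2, .add 32 23 31, .load 33 32])
                  (.ite (.lt 33 2)
                    (blk [.add 33 28 2, .store 32 33, .store 26 31, .add 26 26 2])
                    .skip))))))))

/-- The registers and the memory during a search with marks `D` and list of reached vertices `q`
that was started in state `s₀`. -/
structure BfsMem (n U : ℕ) (s₀ s : State) (D : ℕ → ℕ) (q : List ℕ) : Prop where
  mark : ∀ a < n, s.mem (s₀.reg 23 + a) = D a
  queue : ∀ i, (h : i < q.length) → s.mem (s₀.reg 24 + i) = q[i]
  frame : ∀ a, a < s₀.reg 23 ∨ s₀.reg 23 + 2 * U ≤ a → s.mem a = s₀.mem a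
  tail : s.reg 26 = s₀.reg 24 + q.length
  reg : ∀ r < 25, s.reg r = s₀.reg r

theorem BfsMem.congr {n U : ℕ} {s₀ s s' : State} {D : ℕ → ℕ} {q : List ℕ}
    (h : BfsMem n U s₀ s D q) (hm : s'.mem = s.mem) (h26 : s'.reg 26 = s.reg 26)
    (hr : ∀ r < 25, s'.reg r = s.reg r) : BfsMem n U s₀ s' D q :=
  ⟨fun a ha => by rw [hm, h.mark a ha], fun i hi => by rw [hm, h.queue i hi],
    fun a ha => by rw [hm, h.frame a ha], by rw [h26, h.tail],
    fun r hr' => by rw [hr r hr', h.reg r hr']⟩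

theorem BfsMem.visit {n U : ℕ} {s₀ s s' : State} {D : ℕ → ℕ} {q : List ℕ} {x b : ℕ}
    (h : BfsMem n U s₀ s D q) (hnU : n ≤ U) (hq : q.length < U)
    (h24 : s₀.reg 24 = s₀.reg 23 + U) (hx : x < n)
    (hm : s'.mem = Function.update (Function.update s.mem (s₀.reg 23 + x) b)
      (s₀.reg 24 + q.length) x)
    (h26 : s'.reg 26 = s.reg 26 + 1) (hr : ∀ r < 25, s'.reg r = s.reg r) :
    BfsMem n U s₀ s' (Function.update D x b) (q ++ [x]) := by
  refine ⟨fun a ha => ?_, fun i hi => ?_, fun a ha => ?_, ?_, fun r hr' => ?_⟩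
  · rw [hm, Function.update_of_ne (by omega)]
    by_cases e : a = x
    · simp [e]
    · rw [Function.update_of_ne (by omega), Function.update_of_ne e, h.mark a ha]
  · rw [hm]
    simp only [List.length_append, List.length_singleton] at hi
    by_cases e : i = q.length
    · simp [e]
    · have hi' : i < q.length := by omega
      rw [Function.update_of_ne (by omega), Function.update_of_ne (by omega), h.queue i hi',
        List.getElem_append_left hi']
  · rw [hm, Function.update_of_ne (by omega), Function.update_of_ne (by omega), h.frame a ha]
  · rw [h26, h.tail, List.length_append, List.length_singleton, Nat.add_assoc]
  · rw [hr r hr', h.reg r hr']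

/-- What the search needs to run correctly. -/
structure BfsPre (w n U : ℕ) (A : ℕ → List ℕ) (s : State) : Prop where
  input : IsInput n U A
  inp : Inp n U A s.mem
  one : s.reg 2 = 1
  U_eq : s.reg 3 = U
  src : s.reg 20 < n
  depth : s.reg 22 ≤ n
  queue : s.reg 24 = s.reg 23 + U
  le : 2 * U ≤ s.reg 23
  lt : s.reg 23 + 2 * U < 2 ^ w
  fresh : ∀ a, s.reg 23 ≤ a → a < s.reg 23 + U → s.mem a = 0

/-- The bound `β = D u` is constant during the scan, because every vertex found receives the mark `D
u + 1`. An iteration that finds a vertex takes `1 + 5 + 1 + 5 = 12` steps: loop test, block, branch,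
block. -/
theorem wp_bfsProg_inner {w n U : ℕ} {A : ℕ → List ℕ} {s₀ s : State} {T : ℕ}
    (h₀ : BfsPre w n U A s₀) {D : ℕ → ℕ} {pre rest : List ℕ} {u : ℕ}
    (hu : u ∈ pre)
    (hI : BfsInv n A (s₀.reg 21) (s₀.reg 22) (s₀.reg 20) D pre rest (D u))
    (he : Expands A (s₀.reg 21) (s₀.reg 22) D u)
    (hM : BfsMem n U s₀ s D (pre ++ rest))
    (h25 : s.reg 25 = s₀.reg 24 + pre.length)
    (h28 : s.reg 28 = D u) (h29 : s.reg 29 = off A u + 1)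
    (h30 : s.reg 30 = off A u + 1 + (A u).length)
    {Q : State → ℕ → Prop}
    (hQ : ∀ s' T' D' rest',
      BfsInv n A (s₀.reg 21) (s₀.reg 22) (s₀.reg 20) D' pre rest' (D' u) →
      BfsMem n U s₀ s' D' (pre ++ rest') → s'.reg 25 = s₀.reg 24 + pre.length →
      (∀ x ∈ pre, D' x = D x) →
      (∀ x l, x ∈ pre → Scanned D x l → Scanned D' x l) → Scanned D' u (A u) →
      T' ≤ T + 12 * (A u).length + 1 → Q s' T') :
    WP w (.while (.lt 29 30)
                (.seq (blk [.load 31 29, .add 29 29 2, .add 32 23 31, .load 33 32])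
                  (.ite (.lt 33 2)
                    (blk [.add 33 28 2, .store 32 33, .store 26 31, .add 26 26 2])
                    .skip))) s T Q := by
  have hun : u < n := hI.lt u (by simp [hu])
  have hlen := h₀.input.off_add_le hun
  have hU := h₀.input.lt_U
  refine WP.while (fun i s' T' => ∃ D' rest',
      BfsInv n A (s₀.reg 21) (s₀.reg 22) (s₀.reg 20) D' pre rest' (D' u) ∧
      BfsMem n U s₀ s' D' (pre ++ rest') ∧ s'.reg 25 = s₀.reg 24 + pre.length ∧
      (∀ x ∈ pre, D' x = D x) ∧
      (∀ x l, x ∈ pre → Scanned D x l → Scanned D' x l) ∧ Scanned D' u ((A u).take i) ∧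
      s'.reg 28 = D u ∧ s'.reg 29 = off A u + 1 + i ∧ s'.reg 30 = off A u + 1 + (A u).length ∧
      i ≤ (A u).length ∧ T' ≤ T + 12 * i) (A u).length ?_ ?_ ?_
  · exact ⟨D, rest, hI, hM, h25, fun _ _ => rfl, fun _ _ _ h => h, by simp [Scanned], h28, h29, h30,
      by simp, by simp⟩
  · rintro i s' T' ⟨D', rest', hI', hM', h25', hD', hS', hu', h28', h29', h30', hi, hT'⟩ hb
    simp only [Test.Holds, h29', h30'] at hb
    have hi' : i < (A u).length := by omega
    refine ⟨hi', ?_⟩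
    obtain ⟨x, hx⟩ : ∃ x, x = (A u)[i] := ⟨_, rfl⟩
    have hxA : x ∈ A u := hx ▸ List.getElem_mem hi'
    have hxn : x < n := h₀.input.lt u hun x hxA
    have hmx : s'.mem (off A u + 1 + i) = x := by
      rw [hM'.frame _ (by have := h₀.le; omega), h₀.inp.nbr u hun i hi', hx]
    have hmd : s'.mem (s₀.reg 23 + x) = D' x := hM'.mark x hxn
    have e2 : s'.reg 2 = 1 := by rw [hM'.reg 2 (by norm_num), h₀.one]
    have e23 : s'.reg 23 = s₀.reg 23 := hM'.reg 23 (by norm_num)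
    have htake : (A u).take (i + 1) = (A u).take i ++ [x] := by
      rw [hx, List.take_append_getElem hi']
    have hq := length_le_of_nodup hI'.nodup hI'.lt
    have := h₀.lt
    have := h₀.le
    have := h₀.depth
    have := h₀.queue
    refine WP.seq (WP.blk ?_)
    simp only [Pre, State.setReg, Function.update_self, ne_eq, Nat.reduceEqDiff, not_false_eq_true,
      Function.update_of_ne,
      h29', e2, hmx, e23, hmd]
    refine ⟨by omega, by omega, WP.ite ?_ ?_⟩
    · intro hb'
      simp only [Test.Holds, Function.update_self, ne_eq, Nat.reduceEqDiff, not_false_eq_true,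
        Function.update_of_ne, e2] at hb'
      have hx0 : D' x = 0 := by omega
      have hDu := hD' u hu
      have hux : u ≠ x := fun e => (hI'.mem_iff u).2 (by simp [hu]) (e ▸ hx0)
      have hxq : x ∉ pre ++ rest' := fun h => (hI'.mem_iff x).2 h hx0
      have he' : Expands A (s₀.reg 21) (s₀.reg 22) D' u := ⟨he.1, hDu ▸ he.2⟩
      have hq' : (pre ++ rest').length < n := by
        have : ((pre ++ rest') ++ [x]).length ≤ n := length_le_of_nodup
          (List.Nodup.append hI'.nodup (by simp) (by simpa using hxq))
          (fun y hy => by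
            rcases List.mem_append.1 hy with hy | hy
            · exact hI'.lt y hy
            · rw [List.mem_singleton.1 hy]; exact hxn)
        simp only [List.length_append, List.length_singleton] at this ⊢
        omega
      have := he.2
      refine WP.blk ?_
      have e26 := hM'.tail
      simp only [Pre, State.setReg, State.setMem, Function.update_self, ne_eq, Nat.reduceEqDiff, not_false_eq_true,
        Function.update_of_ne,
        h28', e2, e26]
      refine ⟨by omega, by omega, Function.update D' x (D' u + 1), rest' ++ [x], ?_, ?_, ?_, ?_, ?_,
        ?_, ?_, ?_, ?_, ?_, ?_⟩
      · rw [Function.update_of_ne hux]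
        exact hI'.visit hu hx0 hxn hxA he'
      · rw [← List.append_assoc]
        refine hM'.visit hU.le (by omega) h₀.queue hxn (by rw [hDu]) (by simp [e26]) ?_
        intro r hr
        dsimp only
        repeat rw [Function.update_of_ne (by omega)]
      · simp [h25']
      · intro y hy
        rw [Function.update_of_ne, hD' y hy]
        rintro rfl
        exact hxq (by simp [hy])
      · intro y l hy hl
        refine (hS' y l hy hl).update hx0 ?_
        rintro rfl
        exact hxq (by simp [hy])
      · rw [htake]
        intro y hy
        rcases List.mem_append.1 hy with hy | hy
        · exact hu'.update hx0 hux y hy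
        · rw [List.mem_singleton.1 hy, Function.update_self, Function.update_of_ne hux]
          omega
      · simp
      · omega
      · simp [h30']
      · omega
      · omega
    · intro hb'
      simp only [Test.Holds, Function.update_self, ne_eq, Nat.reduceEqDiff, not_false_eq_true,
        Function.update_of_ne, e2] at hb'
      refine WP.skip ⟨D', rest', hI', hM'.congr rfl (by simp) ?_, ?_, hD', hS', ?_, ?_, ?_, ?_,
        by omega, by omega⟩
      · intro r hr
        dsimp only
        repeat rw [Function.update_of_ne (by omega)]
      · simp [h25']
      · rw [htake]
        intro y hy
        rcases List.mem_append.1 hy with hy | hy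
        · exact hu' y hy
        · rw [List.mem_singleton.1 hy]
          exact ⟨by omega, hI'.high x ((hI'.mem_iff x).1 (by omega))⟩
      · simp [h28']
      · simp [Nat.add_assoc]
      · simp [h30']
  · rintro i s' T' ⟨D', rest', hI', hM', h25', hD', hS', hu', h28', h29', h30', hi, hT'⟩ hb
    simp only [Test.Holds, h29', h30'] at hb
    have : i = (A u).length := by omega
    subst this
    rw [List.take_length] at hu'
    exact hQ s' _ D' rest' hI' hM' h25' hD' hS' hu' (by omega)

theorem wp_bfsProg {w n U : ℕ} {A : ℕ → List ℕ} {s₀ : State} {T : ℕ}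
    (h₀ : BfsPre w n U A s₀) {Q : State → ℕ → Prop}
    (hQ : ∀ s' T' D q, BfsRes n A (s₀.reg 21) (s₀.reg 22) (s₀.reg 20) D q →
      BfsMem n U s₀ s' D q →
      T' ≤ T + 7 + 20 * q.length + 12 * scanCost A (s₀.reg 21) (s₀.reg 22) D q → Q s' T') :
    WP w bfsProg s₀ T Q := by
  have hU := h₀.input.lt_U
  have h1 := h₀.lt
  have h2 := h₀.le
  have h3 := h₀.depth
  have h4 := h₀.queue
  have h5 := h₀.src
  have h6 := h₀.one
  have h7 := h₀.U_eq
  refine WP.seq (WP.blk ?_)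
  simp only [Pre, State.setReg, State.setMem, Function.update_self, ne_eq, Nat.reduceEqDiff,
    not_false_eq_true, Function.update_of_ne, h6]
  refine ⟨by omega, by omega, ?_⟩
  refine WP.while (fun j s T' => ∃ D pre rest β, pre.length = j ∧
      BfsInv n A (s₀.reg 21) (s₀.reg 22) (s₀.reg 20) D pre rest β ∧
      (∀ u ∈ pre, Expands A (s₀.reg 21) (s₀.reg 22) D u → Scanned D u (A u)) ∧
      BfsMem n U s₀ s D (pre ++ rest) ∧ s.reg 25 = s₀.reg 24 + pre.length ∧
      T' ≤ T + 6 + 20 * pre.length + 12 * scanCost A (s₀.reg 21) (s₀.reg 22) D pre) n ?_ ?_ ?_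
  · refine ⟨_, _, _, _, by simp, BfsInv.init h5, by simp, ⟨?_, ?_, ?_, ?_, ?_⟩, ?_, ?_⟩
    · intro a ha
      dsimp only
      rw [Function.update_of_ne (by omega)]
      by_cases e : a = s₀.reg 20
      · simp [e]
      · rw [Function.update_of_ne (by omega), Function.update_of_ne e, h₀.fresh _ (by omega)
          (by omega)]
    · intro i hi
      simp at hi
      simp [hi]
    · intro a ha
      dsimp only
      rw [Function.update_of_ne (by omega), Function.update_of_ne (by omega)]
    · simp
    · intro r hr
      dsimp only
      repeat rw [Function.update_of_ne (by omega)]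
    · simp
    · simp
  · rintro j s T' ⟨D, pre, rest, β, hj, hI, hcl, hM, h25, hT'⟩ hb
    simp only [Test.Holds, h25, hM.tail, List.length_append] at hb
    obtain _ | ⟨u, rest⟩ := rest
    · simp at hb
    have hlen := length_le_of_nodup hI.nodup hI.lt
    simp only [List.length_append, List.length_cons] at hlen hb
    refine ⟨by omega, ?_⟩
    have hun : u < n := hI.lt u (by simp)
    have hI' := hI.pop
    have hlenU := h₀.input.off_add_le hun
    have hM' : BfsMem n U s₀ s D ((pre ++ [u]) ++ rest) := by simpa using hM
    have e2 : s.reg 2 = 1 := by rw [hM.reg 2 (by norm_num), h6]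
    have e23 : s.reg 23 = s₀.reg 23 := hM.reg 23 (by norm_num)
    have e3 : s.reg 3 = U := by rw [hM.reg 3 (by norm_num), h7]
    have e21 : s.reg 21 = s₀.reg 21 := hM.reg 21 (by norm_num)
    have e22 : s.reg 22 = s₀.reg 22 := hM.reg 22 (by norm_num)
    have m1 : s.mem (s₀.reg 24 + pre.length) = u := by
      rw [hM.queue pre.length (by simp)]
      simp
    have m2 : s.mem (s₀.reg 23 + u) = D u := hM.mark u hun
    have m3 : s.mem (U + u) = off A u := by
      rw [hM.frame _ (by omega), h₀.inp.addr u hun]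
    have m4 : s.mem (off A u) = (A u).length := by
      rw [hM.frame _ (by omega), h₀.inp.len u hun]
    -- The scan of `u` does not alter the marks of the vertices that have left the queue, hence not
    -- the decision which of them are expanded; their cost may be evaluated with the new marks.
    have key : ∀ {D' : ℕ → ℕ}, (∀ x ∈ pre ++ [u], D' x = D x) →
        scanCost A (s₀.reg 21) (s₀.reg 22) D' (pre ++ [u]) =
        scanCost A (s₀.reg 21) (s₀.reg 22) D pre +
          if Expands A (s₀.reg 21) (s₀.reg 22) D u then (A u).length else 0 := by
      intro D' hD'
      rw [scanCost_congr hD', scanCost_append]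
      simp [scanCost]
    refine WP.seq (WP.blk ?_)
    simp only [Pre, State.setReg, State.setMem, Function.update_self, ne_eq, Nat.reduceEqDiff,
      not_false_eq_true, Function.update_of_ne, e2, e3, e23, h25, m1, m2, m3, m4]
    refine ⟨by omega, by omega, by omega, ?_⟩
    -- Common to the two branches that do not expand `u`: its degree exceeds the threshold, or its
    -- mark exceeds the depth limit.
    have hskip : ∀ s' T', s'.mem = s.mem → s'.reg 26 = s.reg 26 →
        (∀ r < 25, s'.reg r = s.reg r) → s'.reg 25 = s₀.reg 24 + pre.length + 1 →
        ¬ Expands A (s₀.reg 21) (s₀.reg 22) D u →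
        T' ≤ T + 6 + 20 * pre.length + 12 * scanCost A (s₀.reg 21) (s₀.reg 22) D pre + 20 →
        ∃ D pre rest β, pre.length = j + 1 ∧
        BfsInv n A (s₀.reg 21) (s₀.reg 22) (s₀.reg 20) D pre rest β ∧
        (∀ u ∈ pre, Expands A (s₀.reg 21) (s₀.reg 22) D u → Scanned D u (A u)) ∧
        BfsMem n U s₀ s' D (pre ++ rest) ∧ s'.reg 25 = s₀.reg 24 + pre.length ∧
        T' ≤ T + 6 + 20 * pre.length + 12 * scanCost A (s₀.reg 21) (s₀.reg 22) D pre := by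
      intro s' T' g1 g2 g3 g4 g5 g6
      refine ⟨D, pre ++ [u], rest, D u, by simp [hj], hI', ?_, hM'.congr g1 g2 g3, ?_, ?_⟩
      · intro x hx hxe
        rcases List.mem_append.1 hx with hx | hx
        · exact hcl x hx hxe
        · rw [List.mem_singleton.1 hx] at hxe
          exact absurd hxe g5
      · rw [g4, List.length_append, List.length_singleton, Nat.add_assoc]
      · rw [key fun _ _ => rfl, if_neg g5, List.length_append, List.length_singleton]
        omega
    refine WP.ite ?_ fun hb1 => WP.ite ?_ ?_
    · intro hb1
      simp only [Test.Holds, Function.update_self, ne_eq, Nat.reduceEqDiff, not_false_eq_true,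
        Function.update_of_ne, e21] at hb1
      refine WP.skip (hskip _ _ rfl (by simp) ?_ (by simp) (fun h => by have := h.1; omega)
        (by omega))
      intro r hr
      dsimp only
      repeat rw [Function.update_of_ne (by omega)]
    · intro hb2
      simp only [Test.Holds, Function.update_self, ne_eq, Nat.reduceEqDiff, not_false_eq_true,
        Function.update_of_ne, e22] at hb2
      refine WP.skip (hskip _ _ rfl (by simp) ?_ (by simp) (fun h => by have := h.2; omega)
        (by omega))
      intro r hr
      dsimp only
      repeat rw [Function.update_of_ne (by omega)]
    · intro hb2
      simp only [Test.Holds, Function.update_self, ne_eq, Nat.reduceEqDiff, not_false_eq_true,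
        Function.update_of_ne, e21, e22] at hb1 hb2
      have he : Expands A (s₀.reg 21) (s₀.reg 22) D u := ⟨by omega, by omega⟩
      refine WP.seq (WP.blk ?_)
      simp only [Pre, State.setReg, State.setMem, Function.update_self, ne_eq, Nat.reduceEqDiff,
        not_false_eq_true, Function.update_of_ne, e2]
      refine ⟨by omega, by omega, ?_⟩
      refine wp_bfsProg_inner (D := D) (pre := pre ++ [u]) (rest := rest) (u := u) h₀ (by simp)
        hI' he (hM'.congr ?_ ?_ ?_) ?_ ?_ ?_ ?_ ?_
      · rfl
      · simp
      · intro r hr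
        dsimp only
        repeat rw [Function.update_of_ne (by omega)]
      · simp [Nat.add_assoc]
      · simp
      · simp
      · simp
      · intro s' T'' D' rest' g1 g2 g3 g4 g5 g6 g7
        refine ⟨D', pre ++ [u], rest', D' u, by simp [hj], g1, ?_, g2, g3, ?_⟩
        · intro x hx hxe
          rcases List.mem_append.1 hx with hx' | hx'
          · refine g5 x _ hx (hcl x hx' ?_)
            rwa [Expands, ← g4 x hx]
          · rw [List.mem_singleton.1 hx']
            exact g6
        · rw [key g4, if_pos he, List.length_append, List.length_singleton]
          omega
  · rintro j s T' ⟨D, pre, rest, β, hj, hI, hcl, hM, h25, hT'⟩ hb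
    simp only [Test.Holds, h25, hM.tail, List.length_append] at hb
    obtain rfl : rest = [] := List.eq_nil_of_length_eq_zero (by omega)
    rw [List.append_nil] at hM
    have g := hI
    obtain ⟨g1, g2, g3, -, -, -, g4, g5, g6⟩ := g
    rw [List.append_nil] at g1
    refine hQ s _ D pre ⟨g1, fun u hu => g2 u (by simpa using hu), fun u => by simpa using g3 u,
      g4, g5, g6, hcl⟩ hM (by omega)

/-- Registers `1`, `2`, `3` contain `n`, `1` and the zone size `U`, and the adjacency lists and
their addresses stand in memory. -/
structure Core (n U : ℕ) (A : ℕ → List ℕ) (s : State) : Prop where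
  input : IsInput n U A
  inp : Inp n U A s.mem
  n_eq : s.reg 1 = n
  one : s.reg 2 = 1
  U_eq : s.reg 3 = U

theorem Core.congr {n U : ℕ} {A : ℕ → List ℕ} {s s' : State} (h : Core n U A s)
    (hm : ∀ a < 2 * U, s'.mem a = s.mem a) (hr : ∀ r < 4, s'.reg r = s.reg r) :
    Core n U A s' :=
  ⟨h.input, h.inp.congr h.input hm, by rw [hr _ (by norm_num), h.n_eq],
    by rw [hr _ (by norm_num), h.one], by rw [hr _ (by norm_num), h.U_eq]⟩

/-! ### Addresses of the adjacency lists -/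

/-- Initialize the registers `1`, `2`, `3` and write the addresses of the adjacency lists. -/
def addrProg : Prog :=
  .seq (blk [.const 2 1, .load 1 8, .add 3 1 2, .mul 3 3 3, .move 10 2])
    (.while (.lt 8 1) (blk [.add 11 3 8, .store 11 10, .load 12 10, .add 10 10 12, .add 10 10 2,
      .add 8 8 2]))

/-- Each length cell tells where the next list begins, so one walk over the lists finds all
addresses. Register `8`, still zero, serves first as the address of `n` and then as the counter. -/
theorem wp_addrProg {w n U : ℕ} {A : ℕ → List ℕ} {s : State} {T : ℕ}
    (hA : IsInput n U A) (hU : U = (n + 1) * (n + 1)) (hw : 2 * U < 2 ^ w)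
    (h8 : s.reg 8 = 0) (h0 : s.mem 0 = n)
    (len : ∀ v < n, s.mem (off A v) = (A v).length)
    (nbr : ∀ v < n, ∀ j, (h : j < (A v).length) → s.mem (off A v + 1 + j) = (A v)[j])
    (zero : ∀ a ≥ U, s.mem a = 0) {Q : State → ℕ → Prop}
    (hQ : ∀ s' T', Core n U A s' → (∀ a ≥ 2 * U, s'.mem a = 0) → T' ≤ T + 7 + 8 * n → Q s' T') :
    WP w addrProg s T Q := by
  have hlt := hA.lt_U
  refine WP.seq (WP.blk ?_)
  simp only [Pre, State.setReg, State.setMem, Function.update_self, ne_eq, Nat.reduceEqDiff,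
    not_false_eq_true, Function.update_of_ne, h8, h0, ← hU]
  refine ⟨by omega, by nlinarith, by omega, ?_⟩
  refine WP.while (fun j s' T' => (∀ a, a < U ∨ 2 * U ≤ a → s'.mem a = s.mem a) ∧
    (∀ v < j, s'.mem (U + v) = off A v) ∧ s'.reg 1 = n ∧ s'.reg 2 = 1 ∧ s'.reg 3 = U ∧
    s'.reg 8 = j ∧ s'.reg 10 = off A j ∧ j ≤ n ∧ T' ≤ T + 6 + 8 * j) n ?_ ?_ ?_
  · simp [off, h8]
  · rintro j s' T' ⟨hm, ho, h1, h2, h3, h8', h10, hj, hT⟩ hb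
    simp only [Test.Holds, h1, h8'] at hb
    refine ⟨hb, ?_⟩
    have hl := hA.off_add_le hb
    have e := hm (off A j) (by omega)
    have e' := len j hb
    have hs := off_succ A j
    refine WP.blk ?_
    simp only [Pre, State.setReg, State.setMem, Function.update_self, ne_eq, Nat.reduceEqDiff,
      not_false_eq_true, Function.update_of_ne, h1, h2, h3, h8', h10,
      Function.update_of_ne (show off A j ≠ U + j by omega), e, e']
    refine ⟨by omega, by omega, by omega, by omega, ?_, ?_, trivial, trivial, trivial, trivial,
      by omega, by omega, by omega⟩
    · intro a ha
      rw [Function.update_of_ne (by omega), hm a ha]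
    · intro v hv
      by_cases e : v = j
      · simp [e]
      · rw [Function.update_of_ne (by omega), ho v (by omega)]
  · rintro j s' T' ⟨hm, ho, h1, h2, h3, h8', h10, hj, hT⟩ hb
    simp only [Test.Holds, h1, h8'] at hb
    obtain rfl : j = n := by omega
    refine hQ s' _ ⟨hA, ⟨ho, fun v hv => ?_, fun v hv i hi => ?_⟩, h1, h2, h3⟩ ?_ (by omega)
    · have := hA.off_add_le hv
      rw [hm _ (by omega), len v hv]
    · have := hA.off_add_le hv
      rw [hm _ (by omega), nbr v hv i hi]
    · intro a ha
      rw [hm a (by omega), zero a (by omega)]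

/-! ### The h-index -/

/-- The number of vertices of degree more than `h`. -/
def numGt (n : ℕ) (A : ℕ → List ℕ) (h : ℕ) : ℕ :=
  ((Finset.range n).filter fun v => h < (A v).length).card

/-- Count in register `10` the vertices whose degree exceeds register `4`. -/
def countProg : Prog :=
  .seq (blk [.const 10 0, .const 8 0])
    (.while (.lt 8 1) (.seq (blk [.add 11 3 8, .load 11 11, .load 11 11, .add 8 8 2])
      (.ite (.lt 4 11) (blk [.add 10 10 2]) .skip)))

theorem wp_countProg {w n U : ℕ} {A : ℕ → List ℕ} {s : State} {T : ℕ}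
    (hs : Core n U A s) (hw : 2 * U < 2 ^ w) {Q : State → ℕ → Prop}
    (hQ : ∀ s' T', s'.mem = s.mem → (∀ r < 8, s'.reg r = s.reg r) →
      s'.reg 10 = numGt n A (s.reg 4) → T' ≤ T + 4 + 9 * n → Q s' T') :
    WP w countProg s T Q := by
  have hlt := hs.input.lt_U
  refine WP.seq (WP.blk ?_)
  simp only [Pre, State.setReg, State.setMem, Function.update_self, ne_eq, Nat.reduceEqDiff,
    not_false_eq_true, Function.update_of_ne]
  refine ⟨by omega, by omega, ?_⟩
  refine WP.while (fun j s' T' => s'.mem = s.mem ∧ (∀ r < 8, s'.reg r = s.reg r) ∧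
    s'.reg 8 = j ∧ s'.reg 10 = numGt j A (s.reg 4) ∧ j ≤ n ∧ T' ≤ T + 3 + 9 * j) n ?_ ?_ ?_
  · refine ⟨rfl, ?_, by simp, by simp [numGt], by omega, by omega⟩
    intro r hr
    dsimp only
    rw [Function.update_of_ne (by omega), Function.update_of_ne (by omega)]
  · rintro j s' T' ⟨hm, hr, h8, h10, hj, hT⟩ hb
    have h1 : s'.reg 1 = n := by rw [hr 1 (by norm_num), hs.n_eq]
    have h2 : s'.reg 2 = 1 := by rw [hr 2 (by norm_num), hs.one]
    have h3 : s'.reg 3 = U := by rw [hr 3 (by norm_num), hs.U_eq]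
    have h4 : s'.reg 4 = s.reg 4 := by rw [hr 4 (by norm_num)]
    simp only [Test.Holds, h1, h8] at hb
    have hc : numGt j A (s.reg 4) ≤ j := by
      simpa [numGt] using Finset.card_filter_le (Finset.range j) fun v => s.reg 4 < (A v).length
    have hc' : numGt (j + 1) A (s.reg 4) =
        numGt j A (s.reg 4) + if s.reg 4 < (A j).length then 1 else 0 := by
      unfold numGt
      rw [Finset.range_add_one, Finset.filter_insert]
      split_ifs
      · rw [Finset.card_insert_of_notMem (by simp)]
      · rfl
    refine ⟨hb, WP.seq (WP.blk ?_)⟩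
    simp only [Pre, State.setReg, State.setMem, Function.update_self, ne_eq, Nat.reduceEqDiff,
      not_false_eq_true, Function.update_of_ne, h1, h2, h3, h4, h8, hm, hs.inp.addr j hb,
      hs.inp.len j hb]
    refine ⟨by omega, by omega, WP.ite ?_ ?_⟩
    · intro hb'
      simp only [Test.Holds, Function.update_self, ne_eq, Nat.reduceEqDiff, not_false_eq_true,
        Function.update_of_ne, h4] at hb'
      rw [if_pos hb'] at hc'
      refine WP.blk ?_
      simp only [Pre, State.setReg, State.setMem, Function.update_self, ne_eq, Nat.reduceEqDiff,
        not_false_eq_true, Function.update_of_ne, h2, h10]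
      refine ⟨by omega, trivial, ?_, trivial, hc'.symm, by omega, by omega⟩
      intro r hr'
      repeat rw [Function.update_of_ne (by omega)]
      exact hr r hr'
    · intro hb'
      simp only [Test.Holds, Function.update_self, ne_eq, Nat.reduceEqDiff, not_false_eq_true,
        Function.update_of_ne, h4] at hb'
      rw [if_neg hb'] at hc'
      refine WP.skip ?_
      simp only [Function.update_self, ne_eq, Nat.reduceEqDiff,
        not_false_eq_true, Function.update_of_ne, h10]
      refine ⟨trivial, ?_, trivial, hc'.symm, by omega, by omega⟩
      intro r hr'
      repeat rw [Function.update_of_ne (by omega)]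
      exact hr r hr'
  · rintro j s' T' ⟨hm, hr, h8, h10, hj, hT⟩ hb
    have h1 : s'.reg 1 = n := by rw [hr 1 (by norm_num), hs.n_eq]
    simp only [Test.Holds, h1, h8] at hb
    obtain rfl : j = n := by omega
    exact hQ s' _ hm hr h10 (by omega)

/-- Compute the h-index in register `4`. -/
def hIndexProg : Prog :=
  .seq (blk [.const 4 0]) (.seq countProg
    (.while (.lt 4 10) (.seq (blk [.add 4 4 2]) countProg)))

/-- Trying `0, 1, 2, …` takes `h + 1` counts of `O(n)` steps each, which the term `h (m + n)` pays
for when `h ≥ 1`. The two properties of `numGt` characterise the h-index; see `eq_hIndex`. -/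
theorem wp_hIndexProg {w n U : ℕ} {A : ℕ → List ℕ} {s : State} {T : ℕ}
    (hs : Core n U A s) (hw : 2 * U < 2 ^ w) {Q : State → ℕ → Prop}
    (hQ : ∀ s' T' h, s'.mem = s.mem → (∀ r < 4, s'.reg r = s.reg r) → s'.reg 4 = h →
      numGt n A h ≤ h → (∀ i < h, i < numGt n A i) → T' ≤ T + 7 + 9 * n + (9 * n + 7) * h → Q s' T') :
    WP w hIndexProg s T Q := by
  have hlt := hs.input.lt_U
  have hc : ∀ h, numGt n A h ≤ n := fun h => by
    simpa [numGt] using Finset.card_filter_le (Finset.range n) fun v => h < (A v).length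
  refine WP.seq (WP.blk ?_)
  simp only [Pre, State.setReg, State.setMem, Function.update_self, ne_eq, Nat.reduceEqDiff,
    not_false_eq_true, Function.update_of_ne]
  refine ⟨by omega, WP.seq (wp_countProg (hs.congr ?_ ?_) hw ?_)⟩
  · simp
  · intro r hr
    dsimp only
    rw [Function.update_of_ne (by omega)]
  intro s₁ T₁ hm₁ hr₁ h10 hT₁
  simp only [Function.update_self] at h10
  refine WP.while (fun j s' T' => s'.mem = s.mem ∧ (∀ r < 4, s'.reg r = s.reg r) ∧
    s'.reg 4 = j ∧ s'.reg 10 = numGt n A j ∧ (∀ i < j, i < numGt n A i) ∧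
    T' ≤ T + 6 + 9 * n + (9 * n + 7) * j) n ?_ ?_ ?_
  · refine ⟨hm₁, ?_, ?_, h10, by simp, by omega⟩
    · intro r hr
      rw [hr₁ r (by omega)]
      dsimp only
      rw [Function.update_of_ne (by omega)]
    · rw [hr₁ 4 (by norm_num)]
      simp
  · rintro j s' T' ⟨hm, hr, h4, h10, hi, hT⟩ hb
    have h2 : s'.reg 2 = 1 := by rw [hr 2 (by norm_num), hs.one]
    simp only [Test.Holds, h4, h10] at hb
    have := hc j
    refine ⟨by omega, WP.seq (WP.blk ?_)⟩
    simp only [Pre, State.setReg, State.setMem, Function.update_self, ne_eq, Nat.reduceEqDiff,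
      not_false_eq_true, Function.update_of_ne, h4, h2]
    refine ⟨by omega, wp_countProg (hs.congr ?_ ?_) hw ?_⟩
    · intro a _
      rw [hm]
    · intro r hr'
      dsimp only
      rw [Function.update_of_ne (by omega), hr r hr']
    intro s'' T'' g1 g2 g3 g4
    simp only [Function.update_self] at g3
    refine ⟨by rw [g1, hm], ?_, ?_, g3, ?_, ?_⟩
    · intro r hr'
      rw [g2 r (by omega)]
      dsimp only
      rw [Function.update_of_ne (by omega), hr r hr']
    · rw [g2 4 (by norm_num)]
      simp
    · intro i hij
      by_cases e : i = j
      · rw [e]; exact hb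
      · exact hi i (by omega)
    · rw [Nat.mul_succ]
      omega
  · rintro j s' T' ⟨hm, hr, h4, h10, hi, hT⟩ hb
    simp only [Test.Holds, h4, h10] at hb
    exact hQ s' _ j hm hr h4 (by omega) hi (by omega)

/-! ### Refinement of the vertex types -/

/-- The vertices below `j` have received new types: `F` is the table of types by keys, `G` the list
of current types and `t` the list of old types. -/
structure RefineInv (n U : ℕ) (key t : ℕ → ℕ) (j K : ℕ) (F G : ℕ → ℕ) : Prop where
  rest : ∀ u, j ≤ u → u < n → G u = t u
  done : ∀ u < j, G u = F (key u) ∧ F (key u) ≠ 0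
  le : ∀ i < U, F i ≤ K
  inj : ∀ i < U, ∀ i' < U, F i ≠ 0 → F i = F i' → i = i'
  surj : ∀ k, k ≠ 0 → k ≤ K → ∃ u < j, G u = k
  K_le : K ≤ j

/-- By `done`, earlier keys have nonzero entries, so a zero entry means that the key is new. The
number `K + 1` exceeds all values of `F`, which keeps `F` injective on nonzero entries. -/
theorem RefineInv.new {n U : ℕ} {key t : ℕ → ℕ} {j K : ℕ} {F G F' G' : ℕ → ℕ}
    (h : RefineInv n U key t j K F G) (hj : j < n) (hkey : ∀ u < n, key u < U)
    (h0 : F (key j) = 0) (hF : ∀ i < U, F' i = Function.update F (key j) (K + 1) i)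
    (hG : ∀ u < n, G' u = Function.update G j (K + 1) u) :
    RefineInv n U key t (j + 1) (K + 1) F' G' where
  rest u hu hun := by
    rw [hG u hun, Function.update_of_ne (by omega), h.rest u (by omega) hun]
  done u hu := by
    rw [hG u (by omega), hF _ (hkey u (by omega))]
    by_cases e : u = j
    · simp [e]
    · have h1 := h.done u (by omega)
      have h2 : key u ≠ key j := fun e' => h1.2 (e' ▸ h0)
      rw [Function.update_of_ne e, Function.update_of_ne h2]
      exact h1
  le i hi := by
    rw [hF i hi, Function.update_apply]
    have := h.le i hi
    split_ifs <;> omega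
  inj i hi i' hi' := by
    rw [hF i hi, hF i' hi', Function.update_apply, Function.update_apply]
    have h1 := h.le i hi
    have h2 := h.le i' hi'
    split_ifs with e e'
    · intros; omega
    · intros; omega
    · intros; omega
    · exact h.inj i hi i' hi'
  surj k hk hk' := by
    by_cases e : k = K + 1
    · exact ⟨j, by omega, by rw [hG j hj]; simp [e]⟩
    · obtain ⟨u, hu, hGu⟩ := h.surj k hk (by omega)
      exact ⟨u, by omega, by rw [hG u (by omega), Function.update_of_ne (by omega), hGu]⟩
  K_le := by have := h.K_le; omega

theorem RefineInv.old {n U : ℕ} {key t : ℕ → ℕ} {j K : ℕ} {F G F' G' : ℕ → ℕ}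
    (h : RefineInv n U key t j K F G) (hj : j < n) (hkey : ∀ u < n, key u < U)
    (h0 : F (key j) ≠ 0) (hF : ∀ i < U, F' i = F i)
    (hG : ∀ u < n, G' u = Function.update G j (F (key j)) u) :
    RefineInv n U key t (j + 1) K F' G' where
  rest u hu hun := by
    rw [hG u hun, Function.update_of_ne (by omega), h.rest u (by omega) hun]
  done u hu := by
    rw [hG u (by omega), hF _ (hkey u (by omega))]
    by_cases e : u = j
    · simpa [e] using h0
    · rw [Function.update_of_ne e]
      exact h.done u (by omega)
  le i hi := by rw [hF i hi]; exact h.le i hi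
  inj i hi i' hi' := by rw [hF i hi, hF i' hi']; exact h.inj i hi i' hi'
  surj k hk hk' := by
    obtain ⟨u, hu, hGu⟩ := h.surj k hk hk'
    exact ⟨u, by omega, by rw [hG u (by omega), Function.update_of_ne (by omega), hGu]⟩
  K_le := by have := h.K_le; omega

/-- Replace the types (from the address in register `14` on) by types of pairs of an old type and
a mark (from the address in register `23` on), with the help of a table at the address in
register `13`; count the new types in register `5`. -/
def refineProg : Prog :=
  .while (.lt 15 1)
    (.seq (blk [.add 16 14 15, .load 17 16, .add 18 1 2, .mul 17 17 18, .add 18 23 15, .load 18 18,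
        .add 17 17 18, .add 17 17 13, .load 18 17, .add 15 15 2])
      (.ite (.lt 18 2) (blk [.add 5 5 2, .store 17 5, .store 16 5]) (blk [.store 16 18])))

/-- The pair of old type and mark is written in base `n + 1`; both digits are at most `n`, so keys
stay below `(n + 1) ^ 2 = U`, the zone size. The table starts with zeros, so a single pass over the
vertices suffices and no clearing is needed. -/
theorem wp_refineProg {w n U : ℕ} {s : State} {T : ℕ} {t δ : ℕ → ℕ}
    (hU : U = (n + 1) * (n + 1)) (h1 : s.reg 1 = n) (h2 : s.reg 2 = 1) (h5 : s.reg 5 = 0)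
    (h14 : s.reg 14 = 2 * U) (h15 : s.reg 15 = 0) (h23 : 3 * U ≤ s.reg 23)
    (h13 : s.reg 23 + U ≤ s.reg 13) (hw : s.reg 13 + U < 2 ^ w)
    (ht : ∀ u < n, s.mem (2 * U + u) = t u) (ht' : ∀ u < n, t u ≤ n)
    (hδ : ∀ u < n, s.mem (s.reg 23 + u) = δ u) (hδ' : ∀ u < n, δ u ≤ n)
    (zero : ∀ i < U, s.mem (s.reg 13 + i) = 0)
    {Q : State → ℕ → Prop}
    (hQ : ∀ s' T' (t' : ℕ → ℕ) (K : ℕ), (∀ u < n, s'.mem (2 * U + u) = t' u) →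
      (∀ u < n, ∀ u' < n, t' u = t' u' ↔ t u = t u' ∧ δ u = δ u') →
      (∀ u < n, t' u ≤ K) → (∀ k, k ≠ 0 → k ≤ K → ∃ u < n, t' u = k) → K ≤ n →
      s'.reg 5 = K →
      (∀ a, a < 2 * U ∨ 3 * U ≤ a → a < s.reg 13 ∨ s.reg 13 + U ≤ a → s'.mem a = s.mem a) →
      (∀ r, r ≠ 5 → r < 15 ∨ 19 ≤ r → s'.reg r = s.reg r) → T' ≤ T + 17 * n + 1 → Q s' T') :
    WP w refineProg s T Q := by
  set key : ℕ → ℕ := fun u => t u * (n + 1) + δ u with hkeydef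
  have hkey : ∀ u < n, key u < U := fun u hu => by
    have := ht' u hu
    have := hδ' u hu
    simp only [hkeydef, hU]
    nlinarith
  have hnU : n < U := by nlinarith
  refine WP.while (fun j s' T' => ∃ K, RefineInv n U key t j K (fun i => s'.mem (s.reg 13 + i))
      (fun u => s'.mem (2 * U + u)) ∧ s'.reg 5 = K ∧ s'.reg 15 = j ∧ j ≤ n ∧
      (∀ a, a < 2 * U ∨ 3 * U ≤ a → a < s.reg 13 ∨ s.reg 13 + U ≤ a → s'.mem a = s.mem a) ∧
      (∀ r, r ≠ 5 → r < 15 ∨ 19 ≤ r → s'.reg r = s.reg r) ∧ T' ≤ T + 17 * j) n ?_ ?_ ?_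
  · refine ⟨0, ⟨fun u _ hu => ht u hu, by simp, ?_, ?_, ?_, by simp⟩, h5, h15, by simp,
      fun _ _ _ => rfl, fun _ _ _ => rfl, by simp⟩
    · intro i hi
      simp [zero i hi]
    · intro i hi i' hi' h
      exact absurd (zero i hi) h
    · intro k hk hk'
      omega
  · rintro j s' T' ⟨K, hR, h5', h15', hj, hf, hr, hT⟩ hb
    have e1 : s'.reg 1 = n := by rw [hr 1 (by norm_num) (by norm_num), h1]
    have e2 : s'.reg 2 = 1 := by rw [hr 2 (by norm_num) (by norm_num), h2]
    have e13 : s'.reg 13 = s.reg 13 := hr 13 (by norm_num) (by norm_num)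
    have e14 : s'.reg 14 = 2 * U := by rw [hr 14 (by norm_num) (by norm_num), h14]
    have e23 : s'.reg 23 = s.reg 23 := hr 23 (by norm_num) (by norm_num)
    simp only [Test.Holds, e1, h15'] at hb
    refine ⟨hb, WP.seq (WP.blk ?_)⟩
    have hk := hkey j hb
    have hKj := hR.K_le
    have m1 : s'.mem (2 * U + j) = t j := hR.rest j le_rfl hb
    have m2 : s'.mem (s.reg 23 + j) = δ j := by rw [hf _ (by omega) (by omega), hδ j hb]
    have hkj : t j * (n + 1) + δ j = key j := rfl
    have m3 : key j + s.reg 13 = s.reg 13 + key j := by omega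
    simp only [Pre, State.setReg, State.setMem, Function.update_self, ne_eq, Nat.reduceEqDiff,
      not_false_eq_true, Function.update_of_ne, e1, e2, e13, e14, e23, h15', m1, m2, hkj, m3]
    refine ⟨by omega, by omega, by omega, by omega, by omega, by omega, by omega, WP.ite ?_ ?_⟩
    · intro hb'
      simp only [Test.Holds, Function.update_self, ne_eq, Nat.reduceEqDiff, not_false_eq_true,
        Function.update_of_ne, e2] at hb'
      refine WP.blk ?_
      simp only [Pre, State.setReg, State.setMem, Function.update_self, ne_eq, Nat.reduceEqDiff,
        not_false_eq_true, Function.update_of_ne, e2, h5']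
      refine ⟨by omega, K + 1, hR.new hb hkey (by omega) ?_ ?_, rfl, trivial, by omega, ?_, ?_,
        by omega⟩
      · intro i hi
        rw [Function.update_of_ne (by omega)]
        by_cases e : i = key j
        · simp [e]
        · rw [Function.update_of_ne (by omega), Function.update_of_ne e]
      · intro u hu
        by_cases e : u = j
        · simp [e]
        · rw [Function.update_of_ne (by omega), Function.update_of_ne (by omega),
            Function.update_of_ne e]
      · intro a ha ha'
        rw [Function.update_of_ne (by omega), Function.update_of_ne (by omega), hf a ha ha']
      · intro r h5 hr'
        repeat rw [Function.update_of_ne (by omega)]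
        exact hr r h5 hr'
    · intro hb'
      simp only [Test.Holds, Function.update_self, ne_eq, Nat.reduceEqDiff, not_false_eq_true,
        Function.update_of_ne, e2] at hb'
      refine WP.blk ?_
      simp only [Pre, State.setReg, State.setMem, Function.update_self, ne_eq, Nat.reduceEqDiff,
        not_false_eq_true, Function.update_of_ne, e2, h5']
      refine ⟨K, hR.old hb hkey (by omega) ?_ ?_, rfl, trivial, by omega, ?_, ?_, by omega⟩
      · intro i hi
        rw [Function.update_of_ne (by omega)]
      · intro u hu
        by_cases e : u = j
        · simp [e]
        · rw [Function.update_of_ne (by omega), Function.update_of_ne e]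
      · intro a ha ha'
        rw [Function.update_of_ne (by omega), hf a ha ha']
      · intro r h5 hr'
        repeat rw [Function.update_of_ne (by omega)]
        exact hr r h5 hr'
  · rintro j s' T' ⟨K, hR, h5', h15', hj, hf, hr, hT⟩ hb
    have e1 : s'.reg 1 = n := by rw [hr 1 (by norm_num) (by norm_num), h1]
    simp only [Test.Holds, e1, h15'] at hb
    obtain rfl : j = n := by omega
    refine hQ s' _ (fun u => s'.mem (2 * U + u)) K (fun _ _ => rfl) ?_ ?_ ?_ hR.K_le h5' hf hr
      (by omega)
    · intro u hu u' hu'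
      have d := hR.done u hu
      have d' := hR.done u' hu'
      rw [d.1, d'.1]
      constructor
      · intro h
        have hk : key u = key u' := hR.inj _ (hkey u hu) _ (hkey u' hu') d.2 h
        have a1 := hδ' u hu
        have a2 := hδ' u' hu'
        -- `j` has replaced `n` here; division by the base `j + 1` recovers the leading digit of the
        -- key.
        have b1 : t u = t u' := by
          have := congrArg (· / (j + 1)) hk
          simpa [hkeydef, Nat.add_div_of_dvd_right, Nat.mul_add_div, Nat.mul_comm _ (j + 1),
            Nat.div_eq_of_lt (Nat.lt_succ_of_le a1), Nat.div_eq_of_lt (Nat.lt_succ_of_le a2)]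
            using this
        refine ⟨b1, ?_⟩
        simp only [hkeydef, b1] at hk
        omega
      · rintro ⟨h1, h2⟩
        simp only [hkeydef, h1, h2]
    · intro u hu
      have d := hR.done u hu
      rw [d.1]
      exact hR.le _ (hkey u hu)
    · exact hR.surj

/-! ### The types of the vertices -/

theorem scanCost_le {n : ℕ} {A : ℕ → List ℕ} {thr L : ℕ} {D : ℕ → ℕ} {q : List ℕ} (h : q.Nodup)
    (hlt : ∀ u ∈ q, u < n) :
    scanCost A thr L D q ≤ ∑ u ∈ Finset.range n, (A u).length := by
  unfold scanCost
  rw [← List.sum_toFinset _ h]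
  calc _ ≤ ∑ u ∈ q.toFinset, (A u).length :=
        Finset.sum_le_sum fun u _ => by split_ifs <;> omega
    _ ≤ _ := Finset.sum_le_sum_of_subset fun u hu => by
        simpa using hlt u (by simpa using hu)

/-- The address of the `i`-th group of three memory zones. -/
def zone (U i : ℕ) : ℕ := 5 * U + 3 * U * i

theorem zone_succ (U i : ℕ) : zone U (i + 1) = zone U i + 3 * U := by
  simp only [zone]
  ring

theorem zone_mono (U : ℕ) : Monotone (zone U) :=
  monotone_nat_of_le_succ fun i => by rw [zone_succ]; omega

theorem le_zone (U i : ℕ) : 5 * U ≤ zone U i := Nat.le_add_right _ _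

/-- The vertices below `j` of degree more than `h`. -/
def bigList (A : ℕ → List ℕ) (h j : ℕ) : List ℕ :=
  (List.range j).filter fun v => h < (A v).length

theorem bigList_succ_of_lt {A : ℕ → List ℕ} {h j : ℕ} (hj : h < (A j).length) :
    bigList A h (j + 1) = bigList A h j ++ [j] := by
  simp [bigList, List.range_succ, hj]

theorem bigList_succ_of_not_lt {A : ℕ → List ℕ} {h j : ℕ} (hj : ¬ h < (A j).length) :
    bigList A h (j + 1) = bigList A h j := by
  simp [bigList, List.range_succ, hj]

theorem length_bigList_le (A : ℕ → List ℕ) (h j : ℕ) : (bigList A h j).length ≤ j :=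
  (List.length_filter_le _ _).trans (by simp)

theorem mem_bigList {A : ℕ → List ℕ} {h j v : ℕ} :
    v ∈ bigList A h j ↔ v < j ∧ h < (A v).length := by
  simp [bigList]

/-- `t` assigns types `0, …, K` to the vertices, according to their marks with respect to `Hs`. -/
structure IsTyping (n : ℕ) (δ : ℕ → ℕ → ℕ) (Hs : List ℕ) (t : ℕ → ℕ) (K : ℕ) : Prop where
  eq_iff : ∀ u < n, ∀ u' < n, t u = t u' ↔ ∀ x ∈ Hs, δ x u = δ x u'
  le : ∀ u < n, t u ≤ K
  surj : ∀ k, k ≠ 0 → k ≤ K → ∃ u < n, t u = k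
  K_le : K ≤ n

/-- The memory contains marks with respect to the vertices of `Hs` and the types. -/
structure TypesMem (n U : ℕ) (A : ℕ → List ℕ) (δ : ℕ → ℕ → ℕ) (h : ℕ) (Hs : List ℕ) (t : ℕ → ℕ)
    (K : ℕ) (s : State) : Prop where
  core : Core n U A s
  r4 : s.reg 4 = h
  r5 : s.reg 5 = K
  r7 : s.reg 7 = zone U 0
  r9 : s.reg 9 = 3 * U
  r14 : s.reg 14 = 2 * U
  marks : ∀ i, (hi : i < Hs.length) → ∀ u < n, s.mem (zone U i + u) = δ Hs[i] u
  types : ∀ u < n, s.mem (2 * U + u) = t u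

theorem TypesMem.congr {n U : ℕ} {A : ℕ → List ℕ} {δ : ℕ → ℕ → ℕ} {h : ℕ} {Hs : List ℕ}
    {t : ℕ → ℕ} {K : ℕ} {s s' : State} (hT : TypesMem n U A δ h Hs t K s)
    (hm : ∀ a, a < 3 * U ∨ 5 * U ≤ a → a < zone U Hs.length → s'.mem a = s.mem a)
    (hr : ∀ r, r < 8 ∨ r = 9 ∨ r = 14 → r ≠ 0 → r ≠ 6 → s'.reg r = s.reg r) :
    TypesMem n U A δ h Hs t K s' := by
  have hU := hT.core.input.lt_U
  have hz := le_zone U Hs.length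
  refine ⟨⟨hT.core.input, hT.core.inp.congr hT.core.input ?_, ?_, ?_, ?_⟩, ?_, ?_, ?_, ?_, ?_, ?_,
    ?_⟩
  · exact fun a ha => hm a (by omega) (by omega)
  · rw [hr 1 (by norm_num) (by norm_num) (by norm_num), hT.core.n_eq]
  · rw [hr 2 (by norm_num) (by norm_num) (by norm_num), hT.core.one]
  · rw [hr 3 (by norm_num) (by norm_num) (by norm_num), hT.core.U_eq]
  · rw [hr 4 (by norm_num) (by norm_num) (by norm_num), hT.r4]
  · rw [hr 5 (by norm_num) (by norm_num) (by norm_num), hT.r5]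
  · rw [hr 7 (by norm_num) (by norm_num) (by norm_num), hT.r7]
  · rw [hr 9 (by norm_num) (by norm_num) (by norm_num), hT.r9]
  · rw [hr 14 (by norm_num) (by norm_num) (by norm_num), hT.r14]
  · intro i hi u hu
    have h1 := le_zone U i
    have h2 := zone_mono U (Nat.succ_le_of_lt hi)
    have h3 := zone_succ U i
    simp only [Nat.succ_eq_add_one] at h2
    rw [hm _ (by omega) (by omega), hT.marks i hi u hu]
  · intro u hu
    rw [hm _ (by omega) (by omega), hT.types u hu]

/-- Run a search from each vertex of degree more than register `4`, and compute the types of the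
vertices. -/
def typesProg : Prog :=
  .seq (blk [.add 9 3 3, .add 9 9 3, .add 7 9 3, .add 7 7 3, .move 6 7, .const 5 0, .const 8 0,
      .add 14 3 3])
    (.while (.lt 8 1)
      (.seq (blk [.add 11 3 8, .load 11 11, .load 11 11])
        (.seq (.ite (.lt 4 11)
            (.seq (blk [.move 20 8, .move 21 1, .move 22 1, .move 23 6, .add 24 6 3])
              (.seq bfsProg
                (.seq (blk [.add 13 24 3, .add 6 6 9, .const 5 0, .const 15 0]) refineProg)))
            .skip)
          (blk [.add 8 8 2]))))

/-- The invariant of the main loop of `typesProg`. -/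
structure TypesInv (n U : ℕ) (A : ℕ → List ℕ) (δ : ℕ → ℕ → ℕ) (h : ℕ) (Hs : List ℕ) (t : ℕ → ℕ)
    (K : ℕ) (s : State) : Prop where
  mem : TypesMem n U A δ h Hs t K s
  typing : IsTyping n δ Hs t K
  r6 : s.reg 6 = zone U Hs.length
  zero : ∀ a, 3 * U ≤ a → a < 5 * U → s.mem a = 0
  fresh : ∀ a, zone U Hs.length ≤ a → s.mem a = 0

/-- The part of `typesProg` that handles the vertex in register `8`. -/
theorem wp_types_step {w n U : ℕ} {A : ℕ → List ℕ} {δ : ℕ → ℕ → ℕ} {h : ℕ} {Hs : List ℕ}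
    {t : ℕ → ℕ} {K x : ℕ} {s : State} {T : ℕ} (hU : U = (n + 1) * (n + 1))
    (hI : TypesInv n U A δ h Hs t K s) (hw : zone U (Hs.length + 1) < 2 ^ w)
    (hδ : ∀ D q, BfsRes n A n n x D q → ∀ u < n, D u = δ x u)
    (hδ' : ∀ u < n, δ x u ≤ n) (hx : x < n) (h8 : s.reg 8 = x)
    {Q : State → ℕ → Prop}
    (hQ : ∀ s' T' t' K', TypesInv n U A δ h (Hs ++ [x]) t' K' s' → s'.reg 8 = x →
      T' ≤ T + 37 * n + 12 * ∑ u ∈ Finset.range n, (A u).length + 19 → Q s' T') :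
    WP w (.seq (blk [.move 20 8, .move 21 1, .move 22 1, .move 23 6, .add 24 6 3])
              (.seq bfsProg
                (.seq (blk [.add 13 24 3, .add 6 6 9, .const 5 0, .const 15 0]) refineProg)))
      s T Q := by
  have hT := hI.mem
  have hnU := hT.core.input.lt_U
  have e1 := hT.core.n_eq
  have e2 := hT.core.one
  have e3 := hT.core.U_eq
  have e6 := hI.r6
  have e9 := hT.r9
  have hz := zone_succ U Hs.length
  have hz' := le_zone U Hs.length
  refine WP.seq (WP.blk ?_)
  simp only [Pre, State.setReg, State.setMem, Function.update_self, ne_eq, Nat.reduceEqDiff,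
    not_false_eq_true, Function.update_of_ne, e1, e3, e6, h8]
  -- Threshold and depth limit are both `n`, so this search is unrestricted. The three zones of the
  -- group hold the marks, the queue and the refinement table.
  refine ⟨by omega, WP.seq (wp_bfsProg (n := n) (U := U) (A := A) ?_ ?_)⟩
  · refine ⟨hT.core.input, hT.core.inp, ?_, ?_, ?_, ?_, ?_, ?_, ?_, ?_⟩ <;>
      simp only [Function.update_self, ne_eq, Nat.reduceEqDiff, not_false_eq_true,
        Function.update_of_ne]
    · exact e2
    · exact e3
    · exact hx
    · exact le_rfl
    · omega
    · omega
    · exact fun a ha _ => hI.fresh a ha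
  intro s₁ T₁ D q hB hM hT₁
  simp only [Function.update_self, ne_eq, Nat.reduceEqDiff, not_false_eq_true,
    Function.update_of_ne] at hB hT₁
  have mark : ∀ u < n, s₁.mem (zone U Hs.length + u) = δ x u := by
    intro u hu
    rw [← hδ D q hB u hu, ← hM.mark u hu]
    simp
  have frame : ∀ a, a < zone U Hs.length ∨ zone U Hs.length + 2 * U ≤ a →
      s₁.mem a = s.mem a := by
    intro a ha
    exact hM.frame a (by simpa using ha)
  have hr : ∀ r < 20, s₁.reg r = s.reg r := by
    intro r hr'
    rw [hM.reg r (by omega)]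
    dsimp only
    repeat rw [Function.update_of_ne (by omega)]
  have f23 : s₁.reg 23 = zone U Hs.length := by
    rw [hM.reg 23 (by norm_num)]
    simp
  have f24 : s₁.reg 24 = zone U Hs.length + U := by
    rw [hM.reg 24 (by norm_num)]
    simp
  have f3 : s₁.reg 3 = U := by rw [hr 3 (by norm_num), e3]
  have f6 : s₁.reg 6 = zone U Hs.length := by rw [hr 6 (by norm_num), e6]
  have f9 : s₁.reg 9 = 3 * U := by rw [hr 9 (by norm_num), e9]
  refine WP.seq (WP.blk ?_)
  simp only [Pre, State.setReg, State.setMem, Function.update_self, ne_eq, Nat.reduceEqDiff,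
    not_false_eq_true, Function.update_of_ne, f3, f6, f9, f24]
  refine ⟨by omega, by omega, by omega, by omega, ?_⟩
  refine wp_refineProg (n := n) (U := U) (t := t) (δ := δ x) hU ?_ ?_ ?_ ?_ ?_ ?_ ?_ ?_ ?_ ?_ ?_ hδ'
    ?_ ?_ <;>
      try simp only [Function.update_self, ne_eq, Nat.reduceEqDiff, not_false_eq_true,
        Function.update_of_ne]
  · rw [hr 1 (by norm_num), e1]
  · rw [hr 2 (by norm_num), e2]
  · rw [hr 14 (by norm_num), hT.r14]
  · omega
  · omega
  · omega
  · intro u hu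
    rw [frame _ (by omega), hT.types u hu]
  · intro u hu
    exact (hI.typing.le u hu).trans hI.typing.K_le
  · intro u hu
    rw [f23, mark u hu]
  · intro i hi
    rw [frame _ (by omega), hI.fresh _ (by omega)]
  intro s₂ T₂ t' K' g1 g2 g3 g4 g5 g6 g7 g8 g9
  have k : ∀ r, r ≠ 5 → r ≠ 6 → r < 13 ∨ r = 14 → s₂.reg r = s.reg r := by
    intro r h1 h2 h3
    rw [g8 r h1 (by omega)]
    repeat rw [Function.update_of_ne (by omega)]
    exact hr r (by omega)
  have km : ∀ a, a < 2 * U ∨ 3 * U ≤ a → a < zone U Hs.length ∨ zone U Hs.length + 3 * U ≤ a →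
      s₂.mem a = s.mem a := by
    intro a h1 h2
    rw [g7 a h1 (by omega), frame a (by omega)]
  have hlen : (Hs ++ [x]).length = Hs.length + 1 := by simp
  refine hQ s₂ _ t' K' ⟨⟨hT.core.congr ?_ ?_, ?_, g6, ?_, ?_, ?_, ?_, g1⟩, ⟨?_, g3, g4, g5⟩, ?_,
    ?_, ?_⟩ ?_ ?_
  · exact fun a ha => km a (by omega) (by omega)
  · exact fun r hr' => k r (by omega) (by omega) (by omega)
  · rw [k 4 (by norm_num) (by norm_num) (by norm_num), hT.r4]
  · rw [k 7 (by norm_num) (by norm_num) (by norm_num), hT.r7]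
  · rw [k 9 (by norm_num) (by norm_num) (by norm_num), hT.r9]
  · rw [k 14 (by norm_num) (by norm_num) (by norm_num), hT.r14]
  · intro i hi u hu
    rw [hlen] at hi
    have h1 := le_zone U i
    by_cases e : i = Hs.length
    · subst e
      rw [g7 _ (by omega) (by omega), mark u hu]
      simp
    · have hi' : i < Hs.length := by omega
      have h2 := zone_mono U (Nat.succ_le_of_lt hi')
      have h3 := zone_succ U i
      simp only [Nat.succ_eq_add_one] at h2
      rw [km _ (by omega) (by omega), hT.marks i hi' u hu, List.getElem_append_left hi']
  · intro u hu u' hu'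
    rw [g2 u hu u' hu', hI.typing.eq_iff u hu u' hu']
    simp only [List.mem_append, List.mem_singleton]
    constructor
    · rintro ⟨h1, h2⟩ y (hy | rfl)
      · exact h1 y hy
      · exact h2
    · exact fun h => ⟨fun y hy => h y (Or.inl hy), h x (Or.inr rfl)⟩
  · rw [hlen, hz, g8 6 (by norm_num) (by norm_num)]
    simp
  · intro a h1 h2
    rw [km a (by omega) (by omega), hI.zero a h1 h2]
  · intro a ha
    rw [hlen, hz] at ha
    rw [km a (by omega) (by omega), hI.fresh a (by omega)]
  · rw [k 8 (by norm_num) (by norm_num) (by norm_num), h8]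
  · have h1 := length_le_of_nodup hB.nodup hB.lt
    have h2 := scanCost_le (thr := n) (L := n) (A := A) (D := D) hB.nodup hB.lt
    omega

theorem wp_typesProg {w n U : ℕ} {A : ℕ → List ℕ} {δ : ℕ → ℕ → ℕ} {h : ℕ}
    {s : State} {T : ℕ} (hU : U = (n + 1) * (n + 1)) (hs : Core n U A s)
    (h4 : s.reg 4 = h) (zero : ∀ a ≥ 2 * U, s.mem a = 0) (hw : zone U n < 2 ^ w)
    (hδ : ∀ x < n, ∀ D q, BfsRes n A n n x D q → ∀ u < n, D u = δ x u)
    (hδ' : ∀ x < n, ∀ u < n, δ x u ≤ n) {Q : State → ℕ → Prop}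
    (hQ : ∀ s' T' t K, TypesInv n U A δ h (bigList A h n) t K s' →
      T' ≤ T + 10 + 10 * n +
        (37 * n + 12 * ∑ u ∈ Finset.range n, (A u).length + 19) * (bigList A h n).length →
      Q s' T') :
    WP w typesProg s T Q := by
  have hnU := hs.input.lt_U
  have hz : zone U 0 = 5 * U := by simp [zone]
  have hz' := zone_mono U (Nat.zero_le n)
  have e1 := hs.n_eq
  have e2 := hs.one
  have e3 := hs.U_eq
  refine WP.seq (WP.blk ?_)
  simp only [Pre, State.setReg, State.setMem, Function.update_self, ne_eq, Nat.reduceEqDiff,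
    not_false_eq_true, Function.update_of_ne, e3]
  refine ⟨by omega, by omega, by omega, by omega, by omega, by omega, by omega, ?_⟩
  refine WP.while (fun j s' T' => ∃ t K, TypesInv n U A δ h (bigList A h j) t K s' ∧
    s'.reg 8 = j ∧ j ≤ n ∧ T' ≤ T + 9 + 10 * j +
      (37 * n + 12 * ∑ u ∈ Finset.range n, (A u).length + 19) * (bigList A h j).length) n ?_ ?_ ?_
  -- Before any vertex is handled, all vertices have type `0`. A refinement numbers the types from
  -- `1` on and leaves type `0` empty, which is why `IsTyping.surj` excludes `0`.
  · refine ⟨fun _ => 0, 0, ⟨⟨hs.congr ?_ ?_, ?_, ?_, ?_, ?_, ?_, ?_, ?_⟩, ?_, ?_, ?_, ?_⟩, ?_, ?_, ?_⟩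
    · exact fun _ _ => rfl
    · intro r hr
      dsimp only
      repeat rw [Function.update_of_ne (by omega)]
    · simpa using h4
    · simp
    · simp [hz]; omega
    · simp; omega
    · simp; omega
    · simp [bigList]
    · intro u hu
      exact zero _ (by omega)
    · refine ⟨by simp [bigList], by simp, ?_, by simp⟩
      intro k hk hk'
      omega
    · simp [bigList, hz]; omega
    · exact fun a h1 h2 => zero a (by omega)
    · intro a ha
      simp only [bigList, List.range_zero, List.filter_nil, List.length_nil, hz] at ha
      exact zero a (by omega)
    · simp
    · simp
    · simp [bigList]
  · rintro j s' T' ⟨t, K, hI, h8, hj, hT⟩ hb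
    have hC := hI.mem.core
    simp only [Test.Holds, h8, hC.n_eq] at hb
    have hlen := length_bigList_le A h j
    have hlenU := hC.input.off_add_le hb
    refine ⟨hb, WP.seq (WP.blk ?_)⟩
    simp only [Pre, State.setReg, State.setMem, Function.update_self, ne_eq, Nat.reduceEqDiff,
      not_false_eq_true, Function.update_of_ne, hC.U_eq, h8, hC.inp.addr j hb, hC.inp.len j hb]
    refine ⟨by omega, WP.seq (WP.ite ?_ ?_)⟩
    · intro hb'
      simp only [Test.Holds, Function.update_self, ne_eq, Nat.reduceEqDiff, not_false_eq_true,
        Function.update_of_ne, hI.mem.r4] at hb'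
      have hzz := zone_mono U (show (bigList A h j).length + 1 ≤ n by omega)
      refine wp_types_step (w := w) hU (Hs := bigList A h j) (t := t) (K := K) (x := j) (δ := δ) (h := h)
        ?_ (by omega) (hδ j hb) (hδ' j hb) hb ?_ ?_
      · refine ⟨hI.mem.congr ?_ ?_, hI.typing, ?_, hI.zero, hI.fresh⟩
        · exact fun _ _ _ => rfl
        · intro r hr _ _
          dsimp only
          repeat rw [Function.update_of_ne (by omega)]
        · simpa using hI.r6
      · simpa using h8
      · intro s₁ T₁ t' K' hI' h8' hT₁
        have e2' := hI'.mem.core.one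
        refine WP.blk ?_
        simp only [Pre, State.setReg, State.setMem, Function.update_self, ne_eq, Nat.reduceEqDiff,
          not_false_eq_true, Function.update_of_ne, h8', e2']
        refine ⟨by omega, t', K', ?_, trivial, by omega, ?_⟩
        · rw [bigList_succ_of_lt hb']
          refine ⟨hI'.mem.congr ?_ ?_, hI'.typing, ?_, hI'.zero, hI'.fresh⟩
          · exact fun _ _ _ => rfl
          · intro r hr _ _
            dsimp only
            repeat rw [Function.update_of_ne (by omega)]
          · simpa using hI'.r6
        · rw [bigList_succ_of_lt hb', List.length_append, List.length_singleton,
            Nat.mul_succ (37 * n + 12 * ∑ u ∈ Finset.range n, (A u).length + 19)]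
          omega
    · intro hb'
      simp only [Test.Holds, Function.update_self, ne_eq, Nat.reduceEqDiff, not_false_eq_true,
        Function.update_of_ne, hI.mem.r4] at hb'
      refine WP.skip (WP.blk ?_)
      simp only [Pre, State.setReg, State.setMem, Function.update_self, ne_eq, Nat.reduceEqDiff,
        not_false_eq_true, Function.update_of_ne, h8, hC.one]
      refine ⟨by omega, t, K, ?_, trivial, by omega, ?_⟩
      · rw [bigList_succ_of_not_lt hb']
        refine ⟨hI.mem.congr ?_ ?_, hI.typing, ?_, hI.zero, hI.fresh⟩
        · exact fun _ _ _ => rfl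
        · intro r hr _ _
          dsimp only
          repeat rw [Function.update_of_ne (by omega)]
        · simpa using hI.r6
      · rw [bigList_succ_of_not_lt hb']
        omega
  · rintro j s' T' ⟨t, K, hI, h8, hj, hT⟩ hb
    simp only [Test.Holds, h8, hI.mem.core.n_eq] at hb
    obtain rfl : j = n := by omega
    exact hQ s' _ t K hI (by omega)

/-! ### Sizes and representatives of the types -/

/-- For every type, write its size and one of its members into memory. -/
def sizesProg : Prog :=
  .seq (blk [.const 15 0])
    (.while (.lt 15 1) (blk [.add 16 14 15, .load 17 16, .add 18 9 17, .load 19 18, .add 19 19 2,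
      .store 18 19, .add 18 18 3, .store 18 15, .add 15 15 2]))

/-- The memory contains, in addition to the types, their sizes and representatives. -/
structure SizesMem (n U : ℕ) (A : ℕ → List ℕ) (δ : ℕ → ℕ → ℕ) (h : ℕ) (Hs : List ℕ) (t : ℕ → ℕ)
    (K : ℕ) (s : State) : Prop where
  mem : TypesMem n U A δ h Hs t K s
  typing : IsTyping n δ Hs t K
  size : ∀ k ≤ n, s.mem (3 * U + k) = ((Finset.range n).filter fun u => t u = k).card
  rep_lt : ∀ k ≤ n, s.mem (4 * U + k) < n
  rep : ∀ u < n, t (s.mem (4 * U + t u)) = t u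

theorem SizesMem.congr {n U : ℕ} {A : ℕ → List ℕ} {δ : ℕ → ℕ → ℕ} {h : ℕ} {Hs : List ℕ}
    {t : ℕ → ℕ} {K : ℕ} {s s' : State} (hT : SizesMem n U A δ h Hs t K s)
    (hm : ∀ a < zone U Hs.length, s'.mem a = s.mem a)
    (hr : ∀ r, r < 8 ∨ r = 9 ∨ r = 14 → r ≠ 0 → r ≠ 6 → s'.reg r = s.reg r) :
    SizesMem n U A δ h Hs t K s' := by
  have hU := hT.mem.core.input.lt_U
  have hz := le_zone U Hs.length
  have hK := hT.typing.K_le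
  refine ⟨hT.mem.congr (fun a _ ha => hm a ha) hr, hT.typing, ?_, ?_, ?_⟩
  · intro k hk
    rw [hm _ (by omega), hT.size k hk]
  · intro k hk
    rw [hm _ (by omega)]
    exact hT.rep_lt k hk
  · intro u hu
    have := hT.typing.le u hu
    rw [hm _ (by omega), hT.rep u hu]

theorem wp_sizesProg {w n U : ℕ} {A : ℕ → List ℕ} {δ : ℕ → ℕ → ℕ} {h : ℕ} {Hs : List ℕ}
    {t : ℕ → ℕ} {K : ℕ} {s : State} {T : ℕ} (hn : 0 < n)
    (hI : TypesInv n U A δ h Hs t K s) (hw : zone U 0 < 2 ^ w)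
    {Q : State → ℕ → Prop}
    (hQ : ∀ s' T', SizesMem n U A δ h Hs t K s' → s'.reg 6 = zone U Hs.length →
      (∀ a, zone U Hs.length ≤ a → s'.mem a = 0) → T' ≤ T + 3 + 11 * n → Q s' T') :
    WP w sizesProg s T Q := by
  have hT := hI.mem
  have hnU := hT.core.input.lt_U
  have e1 := hT.core.n_eq
  have e2 := hT.core.one
  have e3 := hT.core.U_eq
  have e9 := hT.r9
  have e14 := hT.r14
  have hz := le_zone U 0
  have hz' := le_zone U Hs.length
  have hK := hI.typing.K_le
  refine WP.seq (WP.blk ?_)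
  simp only [Pre, State.setReg, State.setMem, Function.update_self, ne_eq, Nat.reduceEqDiff,
    not_false_eq_true, Function.update_of_ne]
  refine ⟨by omega, ?_⟩
  refine WP.while (fun j s' T' => (∀ a, a < 3 * U ∨ 5 * U ≤ a → s'.mem a = s.mem a) ∧
    (∀ r < 15, s'.reg r = s.reg r) ∧ s'.reg 15 = j ∧ j ≤ n ∧
    (∀ k ≤ n, s'.mem (3 * U + k) = ((Finset.range j).filter fun u => t u = k).card) ∧
    (∀ k ≤ n, s'.mem (4 * U + k) < n) ∧ (∀ u < j, t (s'.mem (4 * U + t u)) = t u) ∧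
    T' ≤ T + 2 + 11 * j) n ?_ ?_ ?_
  · refine ⟨fun _ _ => rfl, ?_, by simp, by simp, ?_, ?_, by simp, by simp⟩
    · intro r hr
      dsimp only
      rw [Function.update_of_ne (by omega)]
    · intro k hk
      simp only [Finset.range_zero, Finset.filter_empty, Finset.card_empty]
      exact hI.zero _ (by omega) (by omega)
    · intro k hk
      -- A type without members keeps the representative `0`, which is a vertex because `0 < n`.
      rw [hI.zero _ (by omega) (by omega)]
      exact hn
  · rintro j s' T' ⟨hm, hr, h15, hj, hsz, hrl, hrp, hT'⟩ hb
    have f1 : s'.reg 1 = n := by rw [hr 1 (by norm_num), e1]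
    have f2 : s'.reg 2 = 1 := by rw [hr 2 (by norm_num), e2]
    have f3 : s'.reg 3 = U := by rw [hr 3 (by norm_num), e3]
    have f9 : s'.reg 9 = 3 * U := by rw [hr 9 (by norm_num), e9]
    have f14 : s'.reg 14 = 2 * U := by rw [hr 14 (by norm_num), e14]
    simp only [Test.Holds, f1, h15] at hb
    have m1 : s'.mem (2 * U + j) = t j := by rw [hm _ (by omega), hT.types j hb]
    have htj := hI.typing.le j hb
    have m2 := hsz (t j) (by omega)
    have hc : ((Finset.range j).filter fun u => t u = t j).card ≤ j := by
      simpa using Finset.card_filter_le (Finset.range j) fun u => t u = t j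
    have key : ∀ k, ((Finset.range (j + 1)).filter fun u => t u = k).card =
        ((Finset.range j).filter fun u => t u = k).card + if t j = k then 1 else 0 := by
      intro k
      rw [Finset.range_add_one, Finset.filter_insert]
      split_ifs
      · rw [Finset.card_insert_of_notMem (by simp)]
      · rfl
    have m3 : 3 * U + t j + U = 4 * U + t j := by omega
    refine ⟨hb, WP.blk ?_⟩
    simp only [Pre, State.setReg, State.setMem, Function.update_self, ne_eq, Nat.reduceEqDiff,
      not_false_eq_true, Function.update_of_ne, f1, f2, f3, f9, f14, h15, m1, m2, m3]
    refine ⟨by omega, by omega, by omega, by omega, by omega, ?_, ?_, trivial, by omega, ?_, ?_, ?_,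
      by omega⟩
    · intro a ha
      rw [Function.update_of_ne (by omega), Function.update_of_ne (by omega), hm a ha]
    · intro r hr'
      repeat rw [Function.update_of_ne (by omega)]
      exact hr r hr'
    · intro k hk
      rw [Function.update_of_ne (by omega), key k]
      by_cases e : k = t j
      · simp [e]
      · rw [Function.update_of_ne (by omega), if_neg (Ne.symm e), hsz k hk, Nat.add_zero]
    · intro k hk
      by_cases e : k = t j
      · simpa [e] using hb
      · rw [Function.update_of_ne (by omega), Function.update_of_ne (by omega)]
        exact hrl k hk
    · intro u hu
      by_cases e : t u = t j
      · simp [e]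
      · have := hI.typing.le u (by omega)
        have hu' : u < j := by
          rcases Nat.lt_or_ge u j with h' | h'
          · exact h'
          · exact absurd (by rw [show u = j by omega]) e
        rw [Function.update_of_ne (by omega), Function.update_of_ne (by omega), hrp u hu']
  · rintro j s' T' ⟨hm, hr, h15, hj, hsz, hrl, hrp, hT'⟩ hb
    have f1 : s'.reg 1 = n := by rw [hr 1 (by norm_num), e1]
    simp only [Test.Holds, f1, h15] at hb
    obtain rfl : j = n := by omega
    refine hQ s' _ ⟨hT.congr ?_ ?_, hI.typing, hsz, hrl, hrp⟩ ?_ ?_ (by omega)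
    · exact fun a ha _ => hm a ha
    · exact fun r hr' _ _ => hr r (by omega)
    · rw [hr 6 (by norm_num), hI.r6]
    · intro a ha
      rw [hm a (by omega), hI.fresh a ha]

/-! ### Testing an eccentricity -/

/-- The vertices `v` and `u` have no path of length at most `e` through a vertex of `Hs`. -/
def Far (δ : ℕ → ℕ → ℕ) (Hs : List ℕ) (e v u : ℕ) : Prop := ∀ x ∈ Hs, e + 2 < δ x v + δ x u

instance (δ : ℕ → ℕ → ℕ) (Hs : List ℕ) (e v u : ℕ) : Decidable (Far δ Hs e v u) :=
  inferInstanceAs (Decidable (∀ x ∈ Hs, _))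

/-- Write `0` into register `13` unless `Far` holds for the vertices in the registers `8` and `16`
and the number in register `19` less two. -/
def farProg : Prog :=
  .while (.lt 18 11)
    (.seq (blk [.add 20 18 8, .load 20 20, .add 21 18 16, .load 21 21, .add 20 20 21, .add 18 18 9])
      (.ite (.lt 19 20) .skip (blk [.const 13 0])))

theorem wp_farProg {w n U : ℕ} {A : ℕ → List ℕ} {δ : ℕ → ℕ → ℕ} {h : ℕ} {Hs : List ℕ}
    {t : ℕ → ℕ} {K v u e : ℕ} {s : State} {T : ℕ} (hs : TypesMem n U A δ h Hs t K s)
    (hδ' : ∀ x ∈ Hs, ∀ u < n, δ x u ≤ n)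
    (hw : zone U (Hs.length + 1) < 2 ^ w) (hv : v < n) (hu : u < n)
    (h8 : s.reg 8 = v) (h11 : s.reg 11 = zone U Hs.length) (h13 : s.reg 13 = 1)
    (h16 : s.reg 16 = u) (h18 : s.reg 18 = zone U 0) (h19 : s.reg 19 = e + 2)
    {Q : State → ℕ → Prop}
    (hQ : ∀ s' T', s'.mem = s.mem → (∀ r, r < 13 ∨ 14 ≤ r → r < 18 → s'.reg r = s.reg r) →
      s'.reg 13 = (if Far δ Hs e v u then 1 else 0) → T' ≤ T + 11 * Hs.length + 1 → Q s' T') :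
    WP w farProg s T Q := by
  have hnU := hs.core.input.lt_U
  have hz := le_zone U Hs.length
  have hzs := zone_succ U Hs.length
  refine WP.while (fun j s' T' => s'.mem = s.mem ∧
    (∀ r, r < 13 ∨ 14 ≤ r → r < 18 → s'.reg r = s.reg r) ∧ s'.reg 19 = e + 2 ∧
    s'.reg 18 = zone U j ∧ j ≤ Hs.length ∧
    s'.reg 13 = (if Far δ (Hs.take j) e v u then 1 else 0) ∧ T' ≤ T + 11 * j) Hs.length ?_ ?_ ?_
  · simp [Far, h13, h18, h19]
  · rintro j s' T' ⟨hm, hr, h19', h18', hj, h13', hT⟩ hb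
    have f8 : s'.reg 8 = v := by rw [hr 8 (by norm_num) (by norm_num), h8]
    have f9 : s'.reg 9 = 3 * U := by rw [hr 9 (by norm_num) (by norm_num), hs.r9]
    have f11 : s'.reg 11 = zone U Hs.length := by rw [hr 11 (by norm_num) (by norm_num), h11]
    have f16 : s'.reg 16 = u := by rw [hr 16 (by norm_num) (by norm_num), h16]
    simp only [Test.Holds, f11, h18'] at hb
    -- The loop compares addresses of zones; monotonicity of `zone` turns this into a comparison of
    -- indices.
    have hj' : j < Hs.length := by
      by_contra h
      have := zone_mono U (show Hs.length ≤ j by omega)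
      omega
    have hzj := zone_succ U j
    have hzj' := zone_mono U (Nat.succ_le_of_lt hj')
    simp only [Nat.succ_eq_add_one] at hzj'
    have m1 := hs.marks j hj' v hv
    have m2 := hs.marks j hj' u hu
    have b1 := hδ' _ (List.getElem_mem hj') v hv
    have b2 := hδ' _ (List.getElem_mem hj') u hu
    have hfar : Far δ (Hs.take (j + 1)) e v u ↔
        Far δ (Hs.take j) e v u ∧ e + 2 < δ Hs[j] v + δ Hs[j] u := by
      rw [← List.take_append_getElem hj']
      simp only [Far, List.mem_append, List.mem_singleton]
      constructor
      · exact fun h => ⟨fun x hx => h x (Or.inl hx), h _ (Or.inr rfl)⟩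
      · rintro ⟨h1, h2⟩ x (hx | rfl)
        · exact h1 x hx
        · exact h2
    refine ⟨hj', WP.seq (WP.blk ?_)⟩
    simp only [Pre, State.setReg, State.setMem, Function.update_self, ne_eq, Nat.reduceEqDiff,
      not_false_eq_true, Function.update_of_ne, f8, f9, f16, h18', hm, m1, m2]
    refine ⟨by omega, by omega, by omega, by omega, WP.ite ?_ ?_⟩
    · intro hb'
      simp only [Test.Holds, Function.update_self, ne_eq, Nat.reduceEqDiff, not_false_eq_true,
        Function.update_of_ne, h19'] at hb'
      refine WP.skip ?_
      simp only [Function.update_self, ne_eq, Nat.reduceEqDiff, not_false_eq_true,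
        Function.update_of_ne, h13', h19']
      refine ⟨trivial, ?_, trivial, by omega, by omega, ?_, by omega⟩
      · intro r hr1 hr2
        repeat rw [Function.update_of_ne (by omega)]
        exact hr r hr1 hr2
      · simp only [hfar, hb', and_true]
    · intro hb'
      simp only [Test.Holds, Function.update_self, ne_eq, Nat.reduceEqDiff, not_false_eq_true,
        Function.update_of_ne, h19'] at hb'
      refine WP.blk ?_
      simp only [Pre, State.setReg, State.setMem, Function.update_self, ne_eq, Nat.reduceEqDiff,
        not_false_eq_true, Function.update_of_ne, h13', h19']
      refine ⟨by omega, trivial, ?_, trivial, by omega, by omega, ?_, by omega⟩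
      · intro r hr1 hr2
        repeat rw [Function.update_of_ne (by omega)]
        exact hr r hr1 hr2
      · simp only [hfar, hb', and_false, if_false]
  · rintro j s' T' ⟨hm, hr, h19', h18', hj, h13', hT⟩ hb
    have f11 : s'.reg 11 = zone U Hs.length := by rw [hr 11 (by norm_num) (by norm_num), h11]
    simp only [Test.Holds, f11, h18'] at hb
    obtain rfl : j = Hs.length := by
      by_contra h
      have h1 := zone_mono U (show j + 1 ≤ Hs.length by omega)
      have h2 := zone_succ U j
      omega
    rw [List.take_length] at h13'
    exact hQ s' _ hm hr h13' (by omega)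

/-- For each type, write into memory whether its members are `Far` from the vertex in register `8`
for the number in register `0`, and count those members in register `10`. -/
def flagsProg : Prog :=
  .seq (blk [.const 10 0, .const 15 0])
    (.while (.lt 15 12)
      (.seq (blk [.add 16 9 15, .load 17 16, .add 16 16 3, .load 16 16, .move 18 7, .const 13 1,
          .add 19 0 2, .add 19 19 2])
        (.seq farProg (blk [.add 20 6 15, .store 20 13, .mul 13 13 17, .add 10 10 13, .add 15 15 2]))))

/-- `Far` depends on `u` only through its marks with respect to `Hs`, hence only on its type. One
evaluation per type, at its representative, weighted by the size of the type, counts all far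
vertices without a loop over the vertices. -/
theorem wp_flagsProg {w n U : ℕ} {A : ℕ → List ℕ} {δ : ℕ → ℕ → ℕ} {h : ℕ} {Hs : List ℕ}
    {t : ℕ → ℕ} {K v e i : ℕ} {s : State} {T : ℕ} (hs : SizesMem n U A δ h Hs t K s)
    (hδ' : ∀ x ∈ Hs, ∀ u < n, δ x u ≤ n)
    (hw : zone U (i + 1) < 2 ^ w) (hi : Hs.length ≤ i) (hv : v < n) (he : e ≤ n)
    (h0 : s.reg 0 = e) (h6 : s.reg 6 = zone U i)
    (h8 : s.reg 8 = v) (h11 : s.reg 11 = zone U Hs.length) (h12 : s.reg 12 = K + 1)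
    {Q : State → ℕ → Prop}
    (hQ : ∀ s' T', (∀ a, a < zone U i ∨ zone U i + U ≤ a → s'.mem a = s.mem a) →
      (∀ r, r < 10 ∨ r = 11 ∨ r = 12 ∨ r = 14 → s'.reg r = s.reg r) →
      (∀ u < n, s'.mem (zone U i + t u) = if Far δ Hs e v u then 1 else 0) →
      s'.reg 10 = ((Finset.range n).filter fun u => Far δ Hs e v u).card →
      T' ≤ T + 4 + (K + 1) * (11 * Hs.length + 17) → Q s' T') :
    WP w flagsProg s T Q := by
  have hnU := hs.mem.core.input.lt_U
  have e2 := hs.mem.core.one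
  have e3 := hs.mem.core.U_eq
  have e7 := hs.mem.r7
  have e9 := hs.mem.r9
  have hK := hs.typing.K_le
  have hzi := le_zone U i
  have hzl := zone_mono U hi
  have hzl1 := zone_mono U (Nat.add_le_add_right hi 1)
  have hzs := zone_succ U i
  have farT : ∀ u < n, ∀ u' < n, t u = t u' → (Far δ Hs e v u ↔ Far δ Hs e v u') := by
    intro u hu u' hu' h
    have := (hs.typing.eq_iff u hu u' hu').1 h
    exact forall₂_congr fun x hx => by rw [this x hx]
  refine WP.seq (WP.blk ?_)
  simp only [Pre, State.setReg, State.setMem, Function.update_self, ne_eq, Nat.reduceEqDiff,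
    not_false_eq_true, Function.update_of_ne]
  refine ⟨by omega, by omega, ?_⟩
  refine WP.while (fun j s' T' => (∀ a, a < zone U i ∨ zone U i + U ≤ a → s'.mem a = s.mem a) ∧
    (∀ r, r < 10 ∨ r = 11 ∨ r = 12 ∨ r = 14 → s'.reg r = s.reg r) ∧ s'.reg 15 = j ∧ j ≤ K + 1 ∧
    (∀ u < n, t u < j → s'.mem (zone U i + t u) = if Far δ Hs e v u then 1 else 0) ∧
    s'.reg 10 = ((Finset.range n).filter fun u => t u < j ∧ Far δ Hs e v u).card ∧
    T' ≤ T + 3 + j * (11 * Hs.length + 17)) (K + 1) ?_ ?_ ?_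
  · refine ⟨fun _ _ => rfl, ?_, by simp, by simp, by simp, by simp, by omega⟩
    intro r hr
    dsimp only
    repeat rw [Function.update_of_ne (by omega)]
  · rintro j s' T' ⟨hm, hr, h15, hj, hf, h10, hT⟩ hb
    have f0 : s'.reg 0 = e := by rw [hr 0 (by norm_num), h0]
    have f2 : s'.reg 2 = 1 := by rw [hr 2 (by norm_num), e2]
    have f3 : s'.reg 3 = U := by rw [hr 3 (by norm_num), e3]
    have f6 : s'.reg 6 = zone U i := by rw [hr 6 (by norm_num), h6]
    have f7 : s'.reg 7 = zone U 0 := by rw [hr 7 (by norm_num), e7]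
    have f8 : s'.reg 8 = v := by rw [hr 8 (by norm_num), h8]
    have f9 : s'.reg 9 = 3 * U := by rw [hr 9 (by norm_num), e9]
    have f11 : s'.reg 11 = zone U Hs.length := by rw [hr 11 (by norm_num), h11]
    have f12 : s'.reg 12 = K + 1 := by rw [hr 12 (by norm_num), h12]
    simp only [Test.Holds, f12, h15] at hb
    have m0 : 3 * U + j + U = 4 * U + j := by omega
    have m1 : s'.mem (3 * U + j) = ((Finset.range n).filter fun u => t u = j).card := by
      rw [hm _ (by omega), hs.size j (by omega)]
    have hrep := hs.rep_lt j (by omega)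
    have m2 : s'.mem (4 * U + j) = s.mem (4 * U + j) := hm _ (by omega)
    obtain ⟨ρ, hρ⟩ : ∃ ρ, ρ = s.mem (4 * U + j) := ⟨_, rfl⟩
    rw [← hρ] at m2 hrep
    -- For an empty type this is vacuous; its flag may be arbitrary, since it is multiplied by the
    -- size `0`.
    have farρ : ∀ u < n, t u = j → (Far δ Hs e v u ↔ Far δ Hs e v ρ) := by
      intro u hu htu
      refine farT u hu ρ hrep ?_
      have := hs.rep u hu
      rw [htu, ← hρ] at this
      rw [htu, this]
    refine ⟨hb, WP.seq (WP.blk ?_)⟩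
    simp only [Pre, State.setReg, State.setMem, Function.update_self, ne_eq, Nat.reduceEqDiff,
      not_false_eq_true, Function.update_of_ne, f0, f2, f3, f7, f9, h15, m0, m1, m2]
    refine ⟨by omega, by omega, by omega, by omega, by omega, WP.seq ?_⟩
    refine wp_farProg (n := n) (U := U) (A := A) (δ := δ) (h := h) (Hs := Hs) (t := t) (K := K)
      (v := v) (u := ρ) (e := e) ?_ hδ' (by omega) hv hrep ?_ ?_ ?_ ?_ ?_ ?_ ?_
    · refine hs.mem.congr ?_ ?_
      · exact fun a _ ha => hm a (by omega)
      · intro r hr' _ _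
        dsimp only
        repeat rw [Function.update_of_ne (by omega)]
        exact hr r (by omega)
    · simpa using f8
    · simpa using f11
    · simp
    · simp
    · simp
    · simp
    intro s₁ T₁ hm₁ hr₁ h13₁ hT₁
    have g : ∀ r, r < 10 ∨ r = 11 ∨ r = 12 ∨ r = 14 → s₁.reg r = s.reg r := by
      intro r hr'
      rw [hr₁ r (by omega) (by omega)]
      dsimp only
      repeat rw [Function.update_of_ne (by omega)]
      exact hr r hr'
    have g2 : s₁.reg 2 = 1 := by rw [g 2 (by norm_num), e2]
    have g6 : s₁.reg 6 = zone U i := by rw [g 6 (by norm_num), h6]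
    have g10 : s₁.reg 10 = s'.reg 10 := by
      rw [hr₁ 10 (by norm_num) (by norm_num)]
      simp
    have g15 : s₁.reg 15 = j := by
      rw [hr₁ 15 (by norm_num) (by norm_num)]
      simpa using h15
    have g17 : s₁.reg 17 = ((Finset.range n).filter fun u => t u = j).card := by
      rw [hr₁ 17 (by norm_num) (by norm_num)]
      simp
    dsimp only at hm₁
    have hsum : ((Finset.range n).filter fun u => t u < j + 1 ∧ Far δ Hs e v u).card =
        ((Finset.range n).filter fun u => t u < j ∧ Far δ Hs e v u).card +
          (if Far δ Hs e v ρ then 1 else 0) * ((Finset.range n).filter fun u => t u = j).card := by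
      have h1 : ((Finset.range n).filter fun u => t u < j + 1 ∧ Far δ Hs e v u) =
          ((Finset.range n).filter fun u => t u < j ∧ Far δ Hs e v u) ∪
          ((Finset.range n).filter fun u => t u = j ∧ Far δ Hs e v u) := by
        ext u
        simp only [Finset.mem_filter, Finset.mem_union, Nat.lt_succ_iff_lt_or_eq]
        tauto
      rw [h1, Finset.card_union_of_disjoint]
      · congr 1
        split_ifs with hF
        · rw [Nat.one_mul]
          congr 1
          ext u
          simp only [Finset.mem_filter, Finset.mem_range]
          constructor
          · tauto
          · rintro ⟨hu, htu⟩
            exact ⟨hu, htu, (farρ u hu htu).2 hF⟩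
        · rw [Nat.zero_mul, Finset.card_eq_zero, Finset.filter_eq_empty_iff]
          rintro u hu ⟨htu, hF'⟩
          exact hF ((farρ u (Finset.mem_range.1 hu) htu).1 hF')
      · rw [Finset.disjoint_filter]
        intros; omega
    have hle : ((Finset.range n).filter fun u => t u < j + 1 ∧ Far δ Hs e v u).card ≤ n := by
      simpa using Finset.card_filter_le (Finset.range n) fun u => t u < j + 1 ∧ Far δ Hs e v u
    refine WP.blk ?_
    simp only [Pre, State.setReg, State.setMem, Function.update_self, ne_eq, Nat.reduceEqDiff,
      not_false_eq_true, Function.update_of_ne, g2, g6, g10, g15, g17, h13₁, h10, ← hsum, hm₁]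
    refine ⟨by omega, by omega, by omega, by omega, ?_, ?_, trivial, by omega, ?_, trivial, ?_⟩
    · intro a ha
      rw [Function.update_of_ne (by omega), hm a ha]
    · intro r hr'
      repeat rw [Function.update_of_ne (by omega)]
      exact g r hr'
    · intro u hu htu
      by_cases e' : t u = j
      · rw [e', Function.update_self]
        simp only [farρ u hu e']
      · rw [Function.update_of_ne (by omega), hf u hu (by omega)]
    · rw [Nat.succ_mul j]
      omega
  · rintro j s' T' ⟨hm, hr, h15, hj, hf, h10, hT⟩ hb
    have f12 : s'.reg 12 = K + 1 := by rw [hr 12 (by norm_num), h12]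
    simp only [Test.Holds, f12, h15] at hb
    obtain rfl : j = K + 1 := by omega
    have hlt : ∀ u < n, t u < K + 1 := fun u hu => Nat.lt_succ_of_le (hs.typing.le u hu)
    refine hQ s' _ hm hr (fun u hu => hf u hu (hlt u hu)) ?_ (by omega)
    rw [h10]
    congr 1
    refine Finset.filter_congr fun u hu => ?_
    simp only [hlt u (Finset.mem_range.1 hu), true_and]

/-- Subtract from register `10` the flags of the types of the vertices in the queue. -/
def discountProg : Prog :=
  .seq (blk [.move 15 24])
    (.while (.lt 15 26) (blk [.load 16 15, .add 16 14 16, .load 16 16, .add 16 16 6, .load 16 16,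
      .sub 10 10 16, .add 15 15 2]))

/-- The queue has no repetitions, so each far vertex in it is subtracted exactly once and the
truncated subtraction never cuts off. What remains is the number of far vertices outside the queue.
-/
theorem wp_discountProg {w n U : ℕ} {t : ℕ → ℕ} {F : ℕ → Prop} [DecidablePred F] {q : List ℕ}
    {z b : ℕ} {s : State} {T : ℕ} (hq : q.Nodup) (hqn : ∀ u ∈ q, u < n) (hnU : n < U)
    (h2 : s.reg 2 = 1) (h6 : s.reg 6 = z) (h14 : s.reg 14 = 2 * U) (h24 : s.reg 24 = b)
    (h26 : s.reg 26 = b + q.length) (hw : b + U < 2 ^ w) (hw' : z + U < 2 ^ w)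
    (hw2 : 3 * U < 2 ^ w)
    (hqueue : ∀ i, (hi : i < q.length) → s.mem (b + i) = q[i])
    (ht : ∀ u < n, s.mem (2 * U + u) = t u) (ht' : ∀ u < n, t u ≤ n)
    (hF : ∀ u < n, s.mem (z + t u) = if F u then 1 else 0)
    (h10 : s.reg 10 = ((Finset.range n).filter F).card)
    {Q : State → ℕ → Prop}
    (hQ : ∀ s' T', s'.mem = s.mem → (∀ r, r < 10 ∨ r = 11 ∨ r = 12 ∨ r = 14 → s'.reg r = s.reg r) →
      (s'.reg 10 = 0 ↔ ∀ u < n, u ∈ q ∨ ¬ F u) → T' ≤ T + 3 + 9 * q.length → Q s' T') :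
    WP w discountProg s T Q := by
  have hlen := length_le_of_nodup hq hqn
  refine WP.seq (WP.blk ?_)
  simp only [Pre, State.setReg, State.setMem, Function.update_self, ne_eq, Nat.reduceEqDiff,
    not_false_eq_true, Function.update_of_ne, h24]
  refine WP.while (fun j s' T' => s'.mem = s.mem ∧
    (∀ r, r ≠ 10 → r ≠ 15 → r ≠ 16 → s'.reg r = s.reg r) ∧ s'.reg 15 = b + j ∧ j ≤ q.length ∧
    s'.reg 10 = ((Finset.range n).filter fun u => u ∉ q.take j ∧ F u).card ∧
    T' ≤ T + 2 + 9 * j) q.length ?_ ?_ ?_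
  · refine ⟨rfl, ?_, by simp, by simp, by simpa using h10, by simp⟩
    intro r _ h15 _
    dsimp only
    rw [Function.update_of_ne h15]
  · rintro j s' T' ⟨hm, hr, h15', hj, h10', hT⟩ hb
    have f2 : s'.reg 2 = 1 := by rw [hr 2 (by norm_num) (by norm_num) (by norm_num), h2]
    have f6 : s'.reg 6 = z := by rw [hr 6 (by norm_num) (by norm_num) (by norm_num), h6]
    have f14 : s'.reg 14 = 2 * U := by rw [hr 14 (by norm_num) (by norm_num) (by norm_num), h14]
    have f26 : s'.reg 26 = b + q.length := by
      rw [hr 26 (by norm_num) (by norm_num) (by norm_num), h26]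
    simp only [Test.Holds, f26, h15'] at hb
    have hj' : j < q.length := by omega
    obtain ⟨x, hx⟩ : ∃ x, x = q[j] := ⟨_, rfl⟩
    have hxn : x < n := hqn x (hx ▸ List.getElem_mem hj')
    have hxt : x ∉ q.take j := by
      have h1 : (q.take (j + 1)).Nodup := hq.sublist (List.take_sublist _ _)
      rw [← List.take_append_getElem hj', List.nodup_append, ← hx] at h1
      intro h
      exact h1.2.2 x h x (by simp) rfl
    have m1 : s.mem (b + j) = x := by rw [hqueue j hj', hx]
    have m2 := ht x hxn
    have m3 := hF x hxn
    have m4 : t x + z = z + t x := Nat.add_comm _ _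
    have m5 := ht' x hxn
    have key : ((Finset.range n).filter fun u => u ∉ q.take (j + 1) ∧ F u).card =
        ((Finset.range n).filter fun u => u ∉ q.take j ∧ F u).card - if F x then 1 else 0 := by
      have h1 : ((Finset.range n).filter fun u => u ∉ q.take (j + 1) ∧ F u) =
          ((Finset.range n).filter fun u => u ∉ q.take j ∧ F u).erase x := by
        ext u
        rw [← List.take_append_getElem hj', ← hx]
        simp only [Finset.mem_filter, Finset.mem_erase, List.mem_append, List.mem_singleton]
        tauto
      rw [h1, Finset.card_erase_eq_ite]
      simp only [Finset.mem_filter, Finset.mem_range, hxn, hxt, not_false_eq_true, true_and]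
      split_ifs <;> rfl
    refine ⟨hj', WP.blk ?_⟩
    simp only [Pre, State.setReg, State.setMem, Function.update_self, ne_eq, Nat.reduceEqDiff,
      not_false_eq_true, Function.update_of_ne, f2, f6, f14, h15', hm, m1, m2, m3, m4, h10', ← key]
    refine ⟨by omega, by omega, by omega, trivial, ?_, by omega, by omega, trivial, by omega⟩
    intro r h10 h15 h16
    repeat rw [Function.update_of_ne (by omega)]
    exact hr r h10 h15 h16
  · rintro j s' T' ⟨hm, hr, h15', hj, h10', hT⟩ hb
    have f26 : s'.reg 26 = b + q.length := by
      rw [hr 26 (by norm_num) (by norm_num) (by norm_num), h26]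
    simp only [Test.Holds, f26, h15'] at hb
    obtain rfl : j = q.length := by omega
    refine hQ s' _ hm (fun r hr' => hr r (by omega) (by omega) (by omega)) ?_ (by omega)
    rw [h10', Finset.card_eq_zero, Finset.filter_eq_empty_iff, List.take_length]
    simp only [Finset.mem_range]
    exact forall₂_congr fun u _ => by tauto

/-- Test whether the eccentricity of the vertex in register `8` is at most register `0`; register
`10` is zero on exit if and only if this is so. -/
def testProg : Prog :=
  .seq flagsProg (.seq (blk [.move 20 8, .move 21 4, .move 22 0, .add 23 6 3, .add 24 23 3])
    (.seq bfsProg discountProg))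

/-- The zones of group `i` hold the flags, the marks and the queue. They contain zeros beforehand,
so the cost involves only the number of types, the number of vertices of `Hs` and the restricted
search, and has no term for clearing. -/
theorem wp_testProg {w n U : ℕ} {A : ℕ → List ℕ} {δ : ℕ → ℕ → ℕ} {h : ℕ} {Hs : List ℕ}
    {t : ℕ → ℕ} {K v e i : ℕ} {s : State} {T : ℕ} (hs : SizesMem n U A δ h Hs t K s)
    (hδ' : ∀ x ∈ Hs, ∀ u < n, δ x u ≤ n)
    (hw : zone U (i + 1) < 2 ^ w) (hi : Hs.length ≤ i) (hv : v < n) (he : e ≤ n)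
    (h0 : s.reg 0 = e) (h6 : s.reg 6 = zone U i)
    (h8 : s.reg 8 = v) (h11 : s.reg 11 = zone U Hs.length) (h12 : s.reg 12 = K + 1)
    (fresh : ∀ a, zone U i ≤ a → s.mem a = 0)
    {Q : State → ℕ → Prop}
    (hQ : ∀ s' T' D q, BfsRes n A h e v D q →
      (s'.reg 10 = 0 ↔ ∀ u < n, u ∈ q ∨ ¬ Far δ Hs e v u) →
      (∀ a, a < zone U i ∨ zone U (i + 1) ≤ a → s'.mem a = s.mem a) →
      (∀ r, r < 10 ∨ r = 11 ∨ r = 12 ∨ r = 14 → s'.reg r = s.reg r) →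
      T' ≤ T + 20 + (K + 1) * (11 * Hs.length + 17) + 29 * q.length + 12 * scanCost A h e D q →
      Q s' T') :
    WP w testProg s T Q := by
  have hC := hs.mem.core
  have hnU := hC.input.lt_U
  have hzi := le_zone U i
  have hzl := zone_mono U hi
  have hzs := zone_succ U i
  refine WP.seq (wp_flagsProg hs hδ' hw hi hv he h0 h6 h8 h11 h12 ?_)
  intro s₁ T₁ hm₁ hr₁ hF h10 hT₁
  have f0 : s₁.reg 0 = e := by rw [hr₁ 0 (by norm_num), h0]
  have f2 : s₁.reg 2 = 1 := by rw [hr₁ 2 (by norm_num), hC.one]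
  have f3 : s₁.reg 3 = U := by rw [hr₁ 3 (by norm_num), hC.U_eq]
  have f4 : s₁.reg 4 = h := by rw [hr₁ 4 (by norm_num), hs.mem.r4]
  have f6 : s₁.reg 6 = zone U i := by rw [hr₁ 6 (by norm_num), h6]
  have f8 : s₁.reg 8 = v := by rw [hr₁ 8 (by norm_num), h8]
  refine WP.seq (WP.blk ?_)
  simp only [Pre, State.setReg, State.setMem, Function.update_self, ne_eq, Nat.reduceEqDiff,
    not_false_eq_true, Function.update_of_ne, f0, f3, f4, f6, f8]
  refine ⟨by omega, by omega, WP.seq (wp_bfsProg (n := n) (U := U) (A := A) ?_ ?_)⟩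
  · refine ⟨hC.input, hC.inp.congr hC.input ?_, ?_, ?_, ?_, ?_, ?_, ?_, ?_, ?_⟩ <;>
      simp only [Function.update_self, ne_eq, Nat.reduceEqDiff, not_false_eq_true,
        Function.update_of_ne]
    · exact fun a ha => hm₁ a (by omega)
    · exact f2
    · exact f3
    · exact hv
    · exact he
    · omega
    · omega
    · intro a h1 h2
      rw [hm₁ a (by omega), fresh a (by omega)]
  intro s₂ T₂ D q hB hM hT₂
  simp only [Function.update_self, ne_eq, Nat.reduceEqDiff, not_false_eq_true,
    Function.update_of_ne] at hB hT₂
  have frame : ∀ a, a < zone U i + U ∨ zone U i + 3 * U ≤ a → s₂.mem a = s₁.mem a := by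
    intro a ha
    refine hM.frame a ?_
    simp only [Function.update_self, ne_eq, Nat.reduceEqDiff, not_false_eq_true,
      Function.update_of_ne]
    omega
  have hr : ∀ r < 20, s₂.reg r = s₁.reg r := by
    intro r hr'
    rw [hM.reg r (by omega)]
    dsimp only
    repeat rw [Function.update_of_ne (by omega)]
  have f24 : s₂.reg 24 = zone U i + U + U := by
    rw [hM.reg 24 (by norm_num)]
    simp
  have hK := hs.typing.K_le
  have f26 : s₂.reg 26 = zone U i + U + U + q.length := by
    rw [hM.tail]
    simp
  refine wp_discountProg (n := n) (U := U) (t := t) (F := Far δ Hs e v) (q := q) (z := zone U i)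
    (b := zone U i + U + U) hB.nodup hB.lt hnU
    ?_ ?_ ?_ f24 f26 (by omega) (by omega) (by omega) ?_ ?_ ?_ ?_ ?_ ?_
  · rw [hr 2 (by norm_num), f2]
  · rw [hr 6 (by norm_num), f6]
  · rw [hr 14 (by norm_num), hr₁ 14 (by norm_num), hs.mem.r14]
  · intro j hj
    rw [← hM.queue j hj]
    simp
  · intro u hu
    rw [frame _ (by omega), hm₁ _ (by omega), hs.mem.types u hu]
  · exact fun u hu => (hs.typing.le u hu).trans hK
  · intro u hu
    have := hs.typing.le u hu
    rw [frame _ (by omega), hF u hu]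
  · rw [hr 10 (by norm_num), h10]
  intro s₃ T₃ hm₃ hr₃ h10₃ hT₃
  refine hQ s₃ T₃ D q hB h10₃ ?_ ?_ (by omega)
  · intro a ha
    rw [hm₃, frame a (by omega), hm₁ a (by omega)]
  · intro r hr'
    rw [hr₃ r hr', hr r (by omega), hr₁ r hr']

/-- Starting with `0` and the first vertex, increase register `0` whenever the eccentricity of the
current vertex is larger, and pass to the next vertex otherwise. -/
def searchProg : Prog :=
  .seq (blk [.const 0 0, .const 8 0, .move 11 6, .add 12 5 2])
    (.while (.lt 8 1) (.seq testProg (.seq (blk [.add 6 6 9])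
      (.ite (.lt 10 2) (blk [.add 8 8 2]) (blk [.add 0 0 2])))))

/-- Every test increases `v + e` by one, where `v` is the current vertex and `e` the guess. Vertices
already passed stay below the guess as it grows, and it grows only if `e < ecc v ≤ d`. So all depths
are at most `d`, one bound `B` serves all tests, and at the end `e` is the maximum of `ecc`. -/
theorem wp_searchProg {w n U : ℕ} {A : ℕ → List ℕ} {δ : ℕ → ℕ → ℕ} {h : ℕ} {Hs : List ℕ}
    {t : ℕ → ℕ} {K : ℕ} {s : State} {T : ℕ} (hs : SizesMem n U A δ h Hs t K s)
    (hδ' : ∀ x ∈ Hs, ∀ u < n, δ x u ≤ n) (hHs : Hs.length ≤ n)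
    (hw : zone U (3 * n) < 2 ^ w)
    (h6 : s.reg 6 = zone U Hs.length)
    (fresh : ∀ a, zone U Hs.length ≤ a → s.mem a = 0)
    {d B : ℕ} {ecc : ℕ → ℕ} (hd : d < n) (hecc : ∀ v < n, ecc v ≤ d)
    (hd' : ∃ v < n, ecc v = d)
    (htest : ∀ v < n, ∀ e ≤ d, ∀ D q, BfsRes n A h e v D q →
      ((∀ u < n, u ∈ q ∨ ¬ Far δ Hs e v u) ↔ ecc v ≤ e) ∧
      29 * q.length + 12 * scanCost A h e D q ≤ B)
    {Q : State → ℕ → Prop}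
    (hQ : ∀ s' T', s'.reg 0 = d →
      T' ≤ T + 6 + (n + d) * ((K + 1) * (11 * Hs.length + 17) + B + 26) → Q s' T') :
    WP w searchProg s T Q := by
  have hnU := hs.mem.core.input.lt_U
  have e2 := hs.mem.core.one
  have e5 := hs.mem.r5
  have hK := hs.typing.K_le
  have hz0 := le_zone U (3 * n)
  refine WP.seq (WP.blk ?_)
  simp only [Pre, State.setReg, State.setMem, Function.update_self, ne_eq, Nat.reduceEqDiff,
    not_false_eq_true, Function.update_of_ne, e2, e5, h6]
  refine ⟨by omega, by omega, by omega, ?_⟩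
  refine WP.while (fun j s' T' => ∃ v e, v + e = j ∧ v ≤ n ∧ e ≤ d ∧ (∀ u < v, ecc u ≤ e) ∧
    SizesMem n U A δ h Hs t K s' ∧ s'.reg 0 = e ∧ s'.reg 6 = zone U (Hs.length + j) ∧
    s'.reg 8 = v ∧ s'.reg 11 = zone U Hs.length ∧ s'.reg 12 = K + 1 ∧
    (∀ a, zone U (Hs.length + j) ≤ a → s'.mem a = 0) ∧
    T' ≤ T + 5 + j * ((K + 1) * (11 * Hs.length + 17) + B + 26)) (n + d) ?_ ?_ ?_
  · refine ⟨0, 0, rfl, by simp, by simp, by simp, hs.congr ?_ ?_, by simp, by simp [h6], by simp,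
      by simp, by simp, fresh, by simp⟩
    · exact fun _ _ => rfl
    · intro r hr h1 h2
      dsimp only
      repeat rw [Function.update_of_ne (by omega)]
  · rintro j s' T' ⟨v, e, hj, hvn, hed, hev, hs', h0', h6', h8', h11', h12', fresh', hT⟩ hb
    simp only [Test.Holds, h8', hs'.mem.core.n_eq] at hb
    -- At most `n` groups are used for `Hs`, and the number of tests is at most `n + d < 2 * n`.
    have hzj := zone_mono U (show Hs.length + j + 1 ≤ 3 * n by omega)
    have hzl := zone_mono U (show Hs.length ≤ Hs.length + j by omega)
    have hzs := zone_succ U (Hs.length + j)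
    refine ⟨by omega, WP.seq (wp_testProg hs' hδ' (i := Hs.length + j) (by omega) (by omega) hb
      (by omega) h0' h6' h8' h11' h12' fresh' ?_)⟩
    intro s₁ T₁ D q hB h10 hm hr hT₁
    obtain ⟨ht1, ht2⟩ := htest v hb e hed D q hB
    rw [ht1] at h10
    have hj1 : (j + 1) * ((K + 1) * (11 * Hs.length + 17) + B + 26) =
      j * ((K + 1) * (11 * Hs.length + 17) + B + 26) +
        ((K + 1) * (11 * Hs.length + 17) + B + 26) := Nat.succ_mul _ _
    have f0 : s₁.reg 0 = e := by rw [hr 0 (by norm_num), h0']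
    have f2 : s₁.reg 2 = 1 := by rw [hr 2 (by norm_num), hs'.mem.core.one]
    have f6 : s₁.reg 6 = zone U (Hs.length + j) := by rw [hr 6 (by norm_num), h6']
    have f8 : s₁.reg 8 = v := by rw [hr 8 (by norm_num), h8']
    have f9 : s₁.reg 9 = 3 * U := by rw [hr 9 (by norm_num), hs'.mem.r9]
    have f11 : s₁.reg 11 = zone U Hs.length := by rw [hr 11 (by norm_num), h11']
    have f12 : s₁.reg 12 = K + 1 := by rw [hr 12 (by norm_num), h12']
    have hfresh : ∀ a, zone U (Hs.length + (j + 1)) ≤ a → s₁.mem a = 0 := by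
      intro a ha
      rw [← Nat.add_assoc] at ha
      rw [hm a (Or.inr ha), fresh' a (by omega)]
    refine WP.seq (WP.blk ?_)
    simp only [Pre, State.setReg, State.setMem, Function.update_self, ne_eq, Nat.reduceEqDiff,
      not_false_eq_true, Function.update_of_ne, f6, f9]
    refine ⟨by omega, WP.ite ?_ ?_⟩
    · intro hb'
      simp only [Test.Holds, Function.update_self, ne_eq, Nat.reduceEqDiff, not_false_eq_true,
        Function.update_of_ne, f2] at hb'
      have hle := h10.1 (by omega)
      refine WP.blk ?_
      simp only [Pre, State.setReg, State.setMem, Function.update_self, ne_eq, Nat.reduceEqDiff,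
        not_false_eq_true, Function.update_of_ne, f2, f8]
      refine ⟨by omega, v + 1, e, by omega, by omega, hed, ?_, hs'.congr ?_ ?_, f0, ?_, rfl, f11,
        f12, hfresh, ?_⟩
      · intro u hu
        by_cases e' : u = v
        · rw [e']; exact hle
        · exact hev u (by omega)
      · exact fun a ha => hm a (by omega)
      · intro r hr1 hr2 hr3
        dsimp only
        repeat rw [Function.update_of_ne (by omega)]
        exact hr r (by omega)
      · rw [← Nat.add_assoc, hzs]
      · rw [hj1]; omega
    · intro hb'
      simp only [Test.Holds, Function.update_self, ne_eq, Nat.reduceEqDiff, not_false_eq_true,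
        Function.update_of_ne, f2] at hb'
      have hnle : ¬ ecc v ≤ e := fun h => by have := h10.2 h; omega
      have := hecc v hb
      refine WP.blk ?_
      simp only [Pre, State.setReg, State.setMem, Function.update_self, ne_eq, Nat.reduceEqDiff,
        not_false_eq_true, Function.update_of_ne, f2, f0]
      refine ⟨by omega, v, e + 1, by omega, by omega, by omega, ?_, hs'.congr ?_ ?_, rfl, ?_, f8, f11,
        f12, hfresh, ?_⟩
      · intro u hu
        have := hev u hu
        omega
      · exact fun a ha => hm a (by omega)
      · intro r hr1 hr2 hr3
        dsimp only
        repeat rw [Function.update_of_ne (by omega)]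
        exact hr r (by omega)
      · rw [← Nat.add_assoc, hzs]
      · rw [hj1]; omega
  · rintro j s' T' ⟨v, e, hj, hvn, hed, hev, hs', h0', h6', h8', h11', h12', fresh', hT⟩ hb
    simp only [Test.Holds, h8', hs'.mem.core.n_eq] at hb
    obtain ⟨u, hu, hud⟩ := hd'
    have := hev u (by omega)
    obtain rfl : e = d := by omega
    obtain rfl : v = n := by omega
    subst hj
    exact hQ s' _ h0' (by omega)

/-- Compute the diameter in register `0`. -/
def diamProg : Prog :=
  .seq addrProg (.seq hIndexProg (.seq typesProg (.seq sizesProg searchProg)))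

/-! ### Distances -/

/-- `dd` is the distance function of the connected graph with adjacency lists `A`. -/
structure IsDist (n : ℕ) (A : ℕ → List ℕ) (dd : ℕ → ℕ → ℕ) : Prop where
  self : ∀ u < n, dd u u = 0
  eq_of_zero : ∀ u < n, ∀ v < n, dd u v = 0 → u = v
  comm : ∀ u < n, ∀ v < n, dd u v = dd v u
  triangle : ∀ u < n, ∀ v < n, ∀ x < n, dd u x ≤ dd u v + dd v x
  adj : ∀ u < n, ∀ v ∈ A u, dd u v = 1
  pred : ∀ v < n, ∀ u < n, ∀ k, dd v u = k + 1 → ∃ p < n, u ∈ A p ∧ dd v p = k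
  lt : ∀ u < n, ∀ v < n, dd u v < n

section

variable {n U : ℕ} {A : ℕ → List ℕ} {dd : ℕ → ℕ → ℕ} {thr L src : ℕ} {D : ℕ → ℕ} {q : List ℕ}

theorem BfsRes.dist_le (hd : IsDist n A dd) (hB : BfsRes n A thr L src D q) {i : ℕ} :
    ∀ u, D u = i + 1 → dd src u ≤ i := by
  have hs : src < n := hB.lt src ((hB.mem_iff src).1 (by rw [hB.src_one]; omega))
  induction i with
  | zero =>
    intro u hu
    rw [hB.one u hu, hd.self src hs]
  | succ i ih =>
    intro u hu
    obtain ⟨-, p, hp, -, hup⟩ := hB.parent u i hu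
    have hpn : p < n := hB.lt p ((hB.mem_iff p).1 (by omega))
    have hun : u < n := hB.lt u ((hB.mem_iff u).1 (by omega))
    have h1 := ih p hp
    have h2 := hd.triangle src hs p hpn u hun
    rw [hd.adj p hpn u hup] at h2
    omega

theorem BfsRes.mark_le (hB : BfsRes n A thr L src D q) (u : ℕ) : D u ≤ L + 1 := by
  match h : D u with
  | 0 => omega
  | 1 => omega
  | i + 2 =>
    have := (hB.parent u i h).1
    omega

/-- Let `p` precede `u` on a shortest path from `src`. Either the route to `p` already meets a
vertex of large degree, or `p` is such a vertex itself, or `p` has degree at most `thr` and mark at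
most `k + 1 ≤ L`; in the last case `p` is expanded and its scan marks `u`. -/
theorem BfsRes.mark_of_dist (hd : IsDist n A dd) (hB : BfsRes n A thr L src D q) {k : ℕ} :
    ∀ u < n, dd src u = k → k ≤ L →
      (∃ x < n, thr < (A x).length ∧ dd src x + dd x u ≤ k) ∨ (D u ≠ 0 ∧ D u ≤ k + 1) := by
  have hs : src < n := hB.lt src ((hB.mem_iff src).1 (by rw [hB.src_one]; omega))
  induction k with
  | zero =>
    intro u hu h _
    obtain rfl := hd.eq_of_zero src hs u hu h
    right
    rw [hB.src_one]
    omega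
  | succ k ih =>
    intro u hu h hL
    obtain ⟨p, hp, hup, hpk⟩ := hd.pred src hs u hu k h
    have hpu := hd.adj p hp u hup
    rcases ih p hp hpk (by omega) with ⟨x, hx, hxt, hxd⟩ | ⟨h0, h1⟩
    · have := hd.triangle x hx p hp u hu
      exact Or.inl ⟨x, hx, hxt, by omega⟩
    · by_cases ht : thr < (A p).length
      · exact Or.inl ⟨p, hp, ht, by omega⟩
      · have := hB.closed p ((hB.mem_iff p).1 h0) ⟨by omega, by omega⟩ u hup
        exact Or.inr ⟨this.1, by omega⟩

theorem IsInput.length_le (hA : IsInput n U A) {u : ℕ} (hu : u < n) : (A u).length ≤ n :=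
  length_le_of_nodup (hA.nodup u hu) (hA.lt u hu)

/-- No degree exceeds `n`, so the first alternative of `BfsRes.mark_of_dist` is impossible. -/
theorem BfsRes.mark_eq (hA : IsInput n U A) (hd : IsDist n A dd) (hB : BfsRes n A n n src D q)
    {u : ℕ} (hu : u < n) : D u = dd src u + 1 := by
  have hs : src < n := hB.lt src ((hB.mem_iff src).1 (by rw [hB.src_one]; omega))
  rcases hB.mark_of_dist hd u hu rfl (hd.lt src hs u hu).le with ⟨x, hx, hxt, -⟩ | ⟨h0, h1⟩
  · have := hA.length_le hx
    omega
  · have := hB.dist_le hd (i := D u - 1) u (by omega)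
    omega

/-- A reached vertex, or one with a short route through a large vertex, has distance at most `e`
because marks and routes bound distances from above. The converse is the dichotomy of
`BfsRes.mark_of_dist`. -/
theorem BfsRes.test_iff (hd : IsDist n A dd) {h e v : ℕ} (hB : BfsRes n A h e v D q) :
    (∀ u < n, u ∈ q ∨ ¬ Far (fun x u => dd x u + 1) (bigList A h n) e v u) ↔
      (Finset.range n).sup (dd v) ≤ e := by
  have hv : v < n := hB.lt v ((hB.mem_iff v).1 (by rw [hB.src_one]; omega))
  rw [Finset.sup_le_iff]
  simp only [Finset.mem_range]
  refine forall₂_congr fun u hu => ⟨?_, fun hle => ?_⟩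
  · rintro (hq | hF)
    · have h0 := (hB.mem_iff u).2 hq
      have h1 := hB.dist_le hd (i := D u - 1) u (by omega)
      have h2 := hB.mark_le u
      omega
    · simp only [Far, not_forall] at hF
      obtain ⟨x, hx, hF⟩ := hF
      have hxn := (mem_bigList.1 hx).1
      have h1 := hd.triangle v hv x hxn u hu
      have h2 := hd.comm v hv x hxn
      omega
  · rcases hB.mark_of_dist hd u hu rfl hle with ⟨x, hx, hxt, hxd⟩ | ⟨h0, -⟩
    · refine Or.inr fun hF => ?_
      have h1 := hF x (mem_bigList.2 ⟨hx, hxt⟩)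
      have h2 := hd.comm v hv x hx
      dsimp only at h1
      omega
    · exact Or.inl ((hB.mem_iff u).1 h0)

/-! ### Sizes of restricted balls and the number of types -/

theorem BfsRes.card_level_le (hB : BfsRes n A thr L src D q) (i : ℕ) :
    ((Finset.range n).filter fun u => D u = i + 1).card ≤ thr ^ i := by
  induction i with
  | zero =>
    rw [pow_zero, Finset.card_le_one]
    intro a ha b hb
    simp only [Finset.mem_filter] at ha hb
    rw [hB.one a ha.2, hB.one b hb.2]
  | succ i ih =>
    set S := (Finset.range n).filter fun u => D u = i + 1
    -- Each vertex of the next level stands in the list of a parent on this level, and parents have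
    -- degree at most `thr`.
    calc _ ≤ ((S.filter fun p => (A p).length ≤ thr).biUnion fun p => (A p).toFinset).card := by
          refine Finset.card_le_card fun u hu => ?_
          simp only [Finset.mem_filter] at hu
          obtain ⟨-, p, hp, hpt, hup⟩ := hB.parent u i hu.2
          have hpn : p < n := hB.lt p ((hB.mem_iff p).1 (by omega))
          simp only [S, Finset.mem_biUnion, Finset.mem_filter, Finset.mem_range, List.mem_toFinset]
          exact ⟨p, ⟨⟨hpn, hp⟩, hpt⟩, hup⟩
      _ ≤ (S.filter fun p => (A p).length ≤ thr).card * thr :=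
          Finset.card_biUnion_le_card_mul _ _ _ fun p hp =>
            (List.toFinset_card_le _).trans (Finset.mem_filter.1 hp).2
      _ ≤ S.card * thr := Nat.mul_le_mul_right _ (Finset.card_filter_le _ _)
      _ ≤ thr ^ i * thr := Nat.mul_le_mul_right _ ih
      _ = _ := (pow_succ _ _).symm

theorem BfsRes.card_ball_le (hB : BfsRes n A thr L src D q) (r : ℕ) :
    ((Finset.range n).filter fun u => D u ≠ 0 ∧ D u ≤ r).card ≤
      ∑ i ∈ Finset.range r, thr ^ i := by
  calc _ ≤ ((Finset.range r).biUnion fun i =>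
        (Finset.range n).filter fun u => D u = i + 1).card := by
        refine Finset.card_le_card fun u hu => ?_
        simp only [Finset.mem_filter, Finset.mem_biUnion, Finset.mem_range] at hu ⊢
        exact ⟨D u - 1, by omega, hu.1, by omega⟩
    _ ≤ _ := Finset.card_biUnion_le.trans (Finset.sum_le_sum fun i _ => hB.card_level_le i)

theorem BfsRes.length_le (hB : BfsRes n A thr L src D q) :
    q.length ≤ ∑ i ∈ Finset.range (L + 1), thr ^ i := by
  rw [← List.toFinset_card_of_nodup hB.nodup]
  refine (Finset.card_le_card fun u hu => ?_).trans (hB.card_ball_le (L + 1))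
  rw [List.mem_toFinset] at hu
  simp only [Finset.mem_filter, Finset.mem_range]
  exact ⟨hB.lt u hu, (hB.mem_iff u).2 hu, hB.mark_le u⟩

/-- Expanded vertices have marks at most `L`, so they lie in a ball one level smaller; multiplying
its bound by the degree bound `thr` shifts the exponents up by one. -/
theorem BfsRes.scanCost_le (hB : BfsRes n A thr L src D q) :
    scanCost A thr L D q ≤ ∑ i ∈ Finset.range (L + 1), thr ^ i := by
  unfold scanCost
  rw [← List.sum_toFinset _ hB.nodup, ← Finset.sum_filter]
  calc _ ≤ (q.toFinset.filter (Expands A thr L D)).card * thr := by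
        refine Finset.sum_le_card_nsmul _ _ _ fun u hu => ?_
        exact (Finset.mem_filter.1 hu).2.1
    _ ≤ (∑ i ∈ Finset.range L, thr ^ i) * thr := by
        refine Nat.mul_le_mul_right _ ((Finset.card_le_card fun u hu => ?_).trans
          (hB.card_ball_le L))
        simp only [Finset.mem_filter, List.mem_toFinset] at hu
        simp only [Finset.mem_filter, Finset.mem_range]
        exact ⟨hB.lt u hu.1, (hB.mem_iff u).2 hu.1, hu.2.2⟩
    _ ≤ _ := by
        rw [Finset.sum_range_succ', Finset.sum_mul]
        exact Nat.le_add_right _ _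

/-- One member is chosen for each nonzero type. The members in `Hs` are at most `Hs.length` many.
Those outside have only positive distances to `Hs`, so their types inject into vectors over `{1, …,
d}`. Excluding the value `0` is essential: `(d + 1) ^ h` would be too large. -/
theorem IsTyping.card_le (hd : IsDist n A dd) {Hs : List ℕ} {t : ℕ → ℕ} {K d : ℕ}
    (ht : IsTyping n (fun x u => dd x u + 1) Hs t K) (hHs : ∀ x ∈ Hs, x < n)
    (hdd : ∀ u < n, ∀ v < n, dd u v ≤ d) : K ≤ d ^ Hs.length + Hs.length := by
  have hex : ∀ k, ∃ u, k ≠ 0 → k ≤ K → u < n ∧ t u = k := by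
    intro k
    by_cases h : k ≠ 0 ∧ k ≤ K
    · obtain ⟨u, hu⟩ := ht.surj k h.1 h.2
      exact ⟨u, fun _ _ => hu⟩
    · exact ⟨0, fun h1 h2 => absurd ⟨h1, h2⟩ h⟩
  choose f hf using hex
  have hf' : ∀ k ∈ Finset.Icc 1 K, f k < n ∧ t (f k) = k := fun k hk => by
    rw [Finset.mem_Icc] at hk
    exact hf k (by omega) hk.2
  rw [show K = (Finset.Icc 1 K).card by simp,
    ← Finset.card_filter_add_card_filter_not fun k => f k ∉ Hs]
  refine Nat.add_le_add ?_ ?_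
  · have h1 : (Fintype.piFinset fun _ : Fin Hs.length => Finset.Icc 1 d).card = d ^ Hs.length := by
      simp
    rw [← h1]
    refine Finset.card_le_card_of_injOn (fun k i => dd Hs[i] (f k)) ?_ ?_
    · intro k hk
      simp only [Finset.coe_filter, Set.mem_ofPred_eq] at hk
      simp only [Finset.mem_coe, Fintype.mem_piFinset, Finset.mem_Icc]
      intro i
      have hi : Hs[i] ∈ Hs := List.getElem_mem _
      refine ⟨Nat.one_le_iff_ne_zero.2 fun h0 => ?_, hdd _ (hHs _ hi) _ (hf' k hk.1).1⟩
      have := hd.eq_of_zero _ (hHs _ hi) _ (hf' k hk.1).1 h0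
      exact hk.2 (this ▸ hi)
    · intro k hk k' hk' heq
      simp only [Finset.coe_filter, Set.mem_ofPred_eq] at hk hk'
      rw [← (hf' k hk.1).2, ← (hf' k' hk'.1).2,
        ht.eq_iff _ (hf' k hk.1).1 _ (hf' k' hk'.1).1]
      intro x hx
      obtain ⟨i, hi, rfl⟩ := List.getElem_of_mem hx
      exact congrArg (· + 1) (congrFun heq ⟨i, hi⟩)
  · refine (Finset.card_le_card_of_injOn f (t := Hs.toFinset) ?_ ?_).trans
      (List.toFinset_card_le _)
    · intro k hk
      simp only [Finset.coe_filter, Set.mem_ofPred_eq, not_not] at hk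
      simpa using hk.2
    · intro k hk k' hk' heq
      simp only [Finset.coe_filter, Set.mem_ofPred_eq] at hk hk'
      rw [← (hf' k hk.1).2, ← (hf' k' hk'.1).2, heq]

theorem length_bigList (n : ℕ) (A : ℕ → List ℕ) (h : ℕ) : (bigList A h n).length = numGt n A h := by
  have hnd : (bigList A h n).Nodup := List.nodup_range.filter _
  rw [← List.toFinset_card_of_nodup hnd, numGt]
  congr 1
  ext u
  simp [mem_bigList]

end

/-- The running time of `diamProg` on a graph with `n` vertices, degree sum `M`, diameter `d`,
h-index `h`, `g` vertices of larger degree and types `0, …, K`. -/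
def diamTime (n M d h g K : ℕ) : ℕ :=
  33 + 38 * n + (9 * n + 7) * h + (37 * n + 12 * M + 19) * g +
    (n + d) * ((K + 1) * (11 * g + 17) + 41 * ∑ i ∈ Finset.range (d + 1), h ^ i + 26)

theorem wp_diamProg {w n U : ℕ} {A : ℕ → List ℕ} {dd : ℕ → ℕ → ℕ} {s : State} {d : ℕ}
    (hn : 0 < n) (hA : IsInput n U A) (hU : U = (n + 1) * (n + 1)) (hw : zone U (3 * n) < 2 ^ w)
    (h8 : s.reg 8 = 0) (h0 : s.mem 0 = n)
    (len : ∀ v < n, s.mem (off A v) = (A v).length)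
    (nbr : ∀ v < n, ∀ j, (h : j < (A v).length) → s.mem (off A v + 1 + j) = (A v)[j])
    (zero : ∀ a ≥ U, s.mem a = 0) (hd : IsDist n A dd)
    (hdd : ∀ u < n, ∀ v < n, dd u v ≤ d) (hdd' : ∃ u < n, ∃ v < n, dd u v = d) :
    WP w diamProg s 0 fun s' T => s'.reg 0 = d ∧ ∃ h K, numGt n A h ≤ h ∧
      (∀ i < h, i < numGt n A i) ∧ K ≤ d ^ numGt n A h + numGt n A h ∧
      T ≤ diamTime n (∑ u ∈ Finset.range n, (A u).length) d h (numGt n A h) K := by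
  have hz0 := le_zone U (3 * n)
  have hzn := zone_mono U (show n ≤ 3 * n by omega)
  have hz1 := zone_mono U (Nat.zero_le (3 * n))
  have hδ' : ∀ x < n, ∀ u < n, dd x u + 1 ≤ n := fun x hx u hu => hd.lt x hx u hu
  refine WP.seq (wp_addrProg hA hU (by omega) h8 h0 len nbr zero ?_)
  intro s₁ T₁ hC hz hT₁
  refine WP.seq (wp_hIndexProg hC (by omega) ?_)
  intro s₂ T₂ h hm₂ hr₂ h4 hh1 hh2 hT₂
  have hC₂ : Core n U A s₂ := hC.congr (fun a _ => by rw [hm₂]) hr₂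
  refine WP.seq (wp_typesProg (δ := fun x u => dd x u + 1) hU hC₂ h4
    (fun a ha => by rw [hm₂, hz a ha]) (by omega)
    (fun x hx D q hB u hu => hB.mark_eq hA hd hu) hδ' ?_)
  intro s₃ T₃ t K hI hT₃
  have hbig : ∀ x ∈ bigList A h n, x < n := fun x hx => (mem_bigList.1 hx).1
  refine WP.seq (wp_sizesProg hn hI (by omega) ?_)
  intro s₄ T₄ hS h6 hfresh hT₄
  obtain ⟨u, hu, v, hv, huv⟩ := hdd'
  -- `41 = 29 + 12`: the coefficients of the number of reached vertices and of the scan cost, both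
  -- of which are bounded by the same geometric sum.
  refine wp_searchProg (d := d) (B := 41 * ∑ i ∈ Finset.range (d + 1), h ^ i)
    (ecc := fun v => (Finset.range n).sup (dd v)) hS (fun x hx => hδ' x (hbig x hx))
    (length_bigList_le A h n) hw h6 hfresh (huv ▸ hd.lt u hu v hv) ?_ ?_ ?_ ?_
  · exact fun x hx => Finset.sup_le fun y hy => hdd x hx y (Finset.mem_range.1 hy)
  · refine ⟨u, hu, le_antisymm ?_ ?_⟩
    · exact Finset.sup_le fun y hy => hdd u hu y (Finset.mem_range.1 hy)
    · rw [← huv]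
      exact Finset.le_sup (f := dd u) (Finset.mem_range.2 hv)
  · intro x hx e he D q hB
    refine ⟨hB.test_iff hd, ?_⟩
    have h1 := hB.length_le
    have h2 := hB.scanCost_le
    have h3 : ∑ i ∈ Finset.range (e + 1), h ^ i ≤ ∑ i ∈ Finset.range (d + 1), h ^ i :=
      Finset.sum_le_sum_of_subset (Finset.range_mono (by omega))
    omega
  · intro s₅ T₅ hres hT₅
    have hK := hI.typing.card_le hd hbig hdd
    rw [length_bigList] at hT₃ hT₅ hK
    refine ⟨hres, h, K, hh1, hh2, hK, ?_⟩
    unfold diamTime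
    omega

/-! ### The bound on the running time -/

theorem sum_pow_le {h : ℕ} (hh : 1 ≤ h) (d : ℕ) :
    ∑ i ∈ Finset.range (d + 1), h ^ i ≤ (d + 1) * h ^ d := by
  calc _ ≤ ∑ _i ∈ Finset.range (d + 1), h ^ d := Finset.sum_le_sum fun i hi =>
        Nat.pow_le_pow_right hh (Nat.lt_succ_iff.1 (Finset.mem_range.1 hi))
    _ = _ := by simp

/-- For `d ≥ 2` the summand `g + 1 ≤ 2 ^ g ≤ d ^ h` is absorbed, so `K + 1 ≤ 2 * d ^ h`, while the
linear factor is at most `28 * h ≤ 28 * h ^ d`. For `d = 1` there is nothing to absorb `g`, whence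
the hypothesis that it vanishes. -/
theorem typeCost_le {d h g K : ℕ} (hd : 1 ≤ d) (hh : 1 ≤ h) (hg : g ≤ h)
    (hK : K ≤ d ^ g + g) (hg1 : d = 1 → g = 0) :
    (K + 1) * (11 * g + 17) ≤ 56 * (d * d ^ h * h ^ d) := by
  have hhd : h ≤ h ^ d := Nat.le_self_pow (by omega) h
  have h1 : 1 ≤ d ^ h := Nat.one_le_pow _ _ hd
  suffices hK' : K + 1 ≤ 2 * d ^ h by
    calc (K + 1) * (11 * g + 17) ≤ (2 * d ^ h) * (28 * h ^ d) := Nat.mul_le_mul hK' (by omega)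
      _ = 1 * (56 * (d ^ h * h ^ d)) := by ring
      _ ≤ d * (56 * (d ^ h * h ^ d)) := Nat.mul_le_mul_right _ hd
      _ = _ := by ring
  by_cases e : d = 1
  · have := hg1 e
    subst this
    rw [e] at hK ⊢
    simp at hK ⊢
    omega
  · have h2 : g + 1 ≤ 2 ^ g := Nat.lt_two_pow_self
    have h3 : 2 ^ g ≤ d ^ g := Nat.pow_le_pow_left (by omega) g
    have h4 : d ^ g ≤ d ^ h := Nat.pow_le_pow_right hd hg
    omega

theorem diamTime_le {n m d h g K : ℕ} (hn : 1 ≤ n) (hdn : d ≤ n) (hd : 1 ≤ d) (hh : 1 ≤ h)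
    (hg : g ≤ h) (hK : K ≤ d ^ g + g) (hg1 : d = 1 → g = 0) :
    diamTime n (2 * m) d h g K ≤ 400 * (h * (m + n) + n * d * (d ^ h * h ^ d)) := by
  set X := d * d ^ h * h ^ d with hX
  have hX1 : 1 ≤ X := Nat.mul_pos (Nat.mul_pos hd (Nat.pow_pos hd)) (Nat.pow_pos hh)
  have h1 := typeCost_le hd hh hg hK hg1
  have h2 : ∑ i ∈ Finset.range (d + 1), h ^ i ≤ 2 * X := by
    refine (sum_pow_le hh d).trans ?_
    calc (d + 1) * h ^ d ≤ (2 * d) * h ^ d := Nat.mul_le_mul_right _ (by omega)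
      _ = 2 * (d * 1 * h ^ d) := by ring
      _ ≤ 2 * X := Nat.mul_le_mul_left _ (Nat.mul_le_mul_right _
          (Nat.mul_le_mul_left _ (Nat.pow_pos hd)))
  -- `164 = 56 + 2 * 41 + 26`, using `1 ≤ X` for the last summand.
  have h3 : (n + d) * ((K + 1) * (11 * g + 17) + 41 * ∑ i ∈ Finset.range (d + 1), h ^ i + 26) ≤
      (2 * n) * (164 * X) := Nat.mul_le_mul (by omega) (by omega)
  have h4 : (37 * n + 12 * (2 * m) + 19) * g ≤ (56 * n + 24 * m) * h :=
    Nat.mul_le_mul (by omega) hg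
  have h5 : (9 * n + 7) * h ≤ (16 * n) * h := Nat.mul_le_mul_right _ (by omega)
  have h6 : n ≤ n * h := Nat.le_mul_of_pos_right n hh
  have h7 : n * d * (d ^ h * h ^ d) = n * X := by rw [hX]; ring
  unfold diamTime
  rw [h7]
  nlinarith [Nat.zero_le (m * h), Nat.zero_le (n * X)]

/-! ### Graphs on `Fin n` -/

section

variable {n : ℕ} (G : SimpleGraph (Fin n)) (adj : Fin n → List (Fin n))

/-- The adjacency lists as lists of natural numbers. -/
def natAdj (v : ℕ) : List ℕ :=
  if h : v < n then (adj ⟨v, h⟩).map Fin.val else []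

/-- The distance as a function of natural numbers. -/
noncomputable def natDist (u v : ℕ) : ℕ :=
  if h : u < n ∧ v < n then G.dist ⟨u, h.1⟩ ⟨v, h.2⟩ else 0

theorem natAdj_val (v : Fin n) : natAdj adj v = (adj v).map Fin.val := by
  simp [natAdj]

theorem natDist_val (u v : Fin n) : natDist G u v = G.dist u v := by
  simp [natDist]

variable {G adj}

theorem length_natAdj [DecidableRel G.Adj] (hadj : IsAdjList G adj) (v : Fin n) :
    (natAdj adj v).length = G.degree v := by
  rw [natAdj_val, List.length_map, ← List.toFinset_card_of_nodup (hadj v).1,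
    ← G.card_neighborFinset_eq_degree]
  congr 1
  ext u
  simp [(hadj v).2 u]

theorem isInput_natAdj (hadj : IsAdjList G adj) :
    IsInput n ((n + 1) * (n + 1)) (natAdj adj) := by
  have hnd : ∀ u < n, (natAdj adj u).Nodup := fun u hu => by
    have := natAdj_val adj ⟨u, hu⟩
    dsimp only at this
    rw [this]
    exact (hadj _).1.map Fin.val_injective
  have hlt : ∀ u < n, ∀ x ∈ natAdj adj u, x < n := fun u hu x hx => by
    have := natAdj_val adj ⟨u, hu⟩
    dsimp only at this
    rw [this] at hx
    obtain ⟨y, -, rfl⟩ := List.mem_map.1 hx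
    exact y.2
  refine ⟨hlt, hnd, ?_, by nlinarith⟩
  calc off (natAdj adj) n ≤ 1 + ∑ _u ∈ Finset.range n, (n + 1) := by
        refine Nat.add_le_add_left (Finset.sum_le_sum fun u hu => ?_) _
        rw [Finset.mem_range] at hu
        exact Nat.add_le_add_right (length_le_of_nodup (hnd u hu) (hlt u hu)) 1
    _ ≤ _ := by
        simp only [Finset.sum_const, Finset.card_range, smul_eq_mul]
        nlinarith

theorem isDist_natDist (hG : G.Connected) (hadj : IsAdjList G adj) :
    IsDist n (natAdj adj) (natDist G) := by
  have e : ∀ u v : Fin n, natDist G u v = G.dist u v := natDist_val G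
  refine ⟨fun u hu => ?_, fun u hu v hv h => ?_, fun u hu v hv => ?_, fun u hu v hv x hx => ?_,
    fun u hu v hv => ?_, fun v hv u hu k h => ?_, fun u hu v hv => ?_⟩
  · have := e ⟨u, hu⟩ ⟨u, hu⟩
    simpa using this
  · rw [e ⟨u, hu⟩ ⟨v, hv⟩, hG.dist_eq_zero_iff] at h
    exact congrArg Fin.val h
  · rw [e ⟨u, hu⟩ ⟨v, hv⟩, e ⟨v, hv⟩ ⟨u, hu⟩, G.dist_comm]
  · rw [e ⟨u, hu⟩ ⟨v, hv⟩, e ⟨v, hv⟩ ⟨x, hx⟩, e ⟨u, hu⟩ ⟨x, hx⟩]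
    exact hG.dist_triangle
  · rw [natAdj_val adj ⟨u, hu⟩] at hv
    obtain ⟨y, hy, rfl⟩ := List.mem_map.1 hv
    rw [e ⟨u, hu⟩ y, SimpleGraph.dist_eq_one_iff_adj]
    exact ((hadj _).2 y).1 hy
  · rw [e ⟨v, hv⟩ ⟨u, hu⟩, G.dist_comm] at h
    obtain ⟨p, hp⟩ := hG.exists_walk_length_eq_dist ⟨u, hu⟩ ⟨v, hv⟩
    rw [h] at hp
    cases p with
    | nil => simp at hp
    | @cons _ y _ hy p =>
      simp only [SimpleGraph.Walk.length_cons, Nat.add_right_cancel_iff] at hp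
      -- The second vertex of a shortest walk from `u` to `v`: the rest of the walk bounds its
      -- distance to `v` from above, the triangle inequality from below.
      refine ⟨y, y.2, ?_, ?_⟩
      · rw [natAdj_val]
        exact List.mem_map.2 ⟨⟨u, hu⟩, ((hadj y).2 _).2 hy.symm, rfl⟩
      · rw [e ⟨v, hv⟩ y, G.dist_comm]
        have h1 := SimpleGraph.dist_le p
        have h2 := hG.dist_triangle (u := (⟨u, hu⟩ : Fin n)) (v := y) (w := ⟨v, hv⟩)
        rw [SimpleGraph.dist_eq_one_iff_adj.2 hy] at h2
        omega
  · rw [e ⟨u, hu⟩ ⟨v, hv⟩]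
    obtain ⟨p, hp, hl⟩ := hG.exists_path_of_dist ⟨u, hu⟩ ⟨v, hv⟩
    have := hp.length_lt
    simpa [hl] using this

theorem numGt_natAdj [DecidableRel G.Adj] (hadj : IsAdjList G adj) (h : ℕ) :
    numGt n (natAdj adj) h = (Finset.univ.filter fun v => h + 1 ≤ G.degree v).card := by
  have : (Finset.range n).filter (fun v => h < (natAdj adj v).length) =
      (Finset.univ.filter fun v => h + 1 ≤ G.degree v).map Fin.valEmbedding := by
    ext v
    simp only [Finset.mem_filter, Finset.mem_range, Finset.mem_map, Finset.mem_univ, true_and,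
      Fin.valEmbedding_apply]
    constructor
    · rintro ⟨hv, hl⟩
      exact ⟨⟨v, hv⟩, by rw [← length_natAdj hadj]; exact hl, rfl⟩
    · rintro ⟨v, hl, rfl⟩
      exact ⟨v.2, by rw [length_natAdj hadj]; exact hl⟩
  rw [numGt, this, Finset.card_map]

/-- `numGt` at `i` counts the degrees that are at least `i + 1`, so `h2` at `h - 1` makes `h`
admissible. For `l > h`, vertices of degree at least `l` are among the at most `h` vertices of
degree more than `h`. -/
theorem eq_hIndex [DecidableRel G.Adj] (hadj : IsAdjList G adj) {h : ℕ}
    (h1 : numGt n (natAdj adj) h ≤ h) (h2 : ∀ i < h, i < numGt n (natAdj adj) i) :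
    h = G.hIndex := by
  refine IsGreatest.unique ⟨?_, fun l hl => ?_⟩ G.isGreatest_hIndex
  · rcases h with _ | i
    · exact Nat.zero_le _
    · have := h2 i (Nat.lt_succ_self i)
      rw [numGt_natAdj hadj] at this
      exact this
  · by_contra hlt
    push Not at hlt
    simp only [Set.mem_ofPred_eq] at hl
    rw [numGt_natAdj hadj] at h1
    have h3 : (Finset.univ.filter fun v => l ≤ G.degree v).card ≤
        (Finset.univ.filter fun v => h + 1 ≤ G.degree v).card :=
      Finset.card_le_card fun v => by
        simp only [Finset.mem_filter, Finset.mem_univ, true_and]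
        omega
    omega

theorem sum_length_natAdj [DecidableRel G.Adj] (hadj : IsAdjList G adj) :
    ∑ u ∈ Finset.range n, (natAdj adj u).length = 2 * G.edgeFinset.card := by
  rw [Finset.sum_range fun u => (natAdj adj u).length, ← G.sum_degrees_eq_twice_card_edges]
  exact Finset.sum_congr rfl fun v _ => length_natAdj hadj v

/-- A graph of diameter `1` is complete, so all degrees are `n - 1` and the count is `0` or `n`; the
value `n` would force `n ≤ h` although `h + 1 ≤ n - 1`. -/
theorem numGt_eq_zero_of_diam_eq_one [DecidableRel G.Adj] [Nontrivial (Fin n)]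
    (hadj : IsAdjList G adj) (hd : G.diam = 1) {h : ℕ} (hh : numGt n (natAdj adj) h ≤ h) :
    numGt n (natAdj adj) h = 0 := by
  have hdeg : ∀ v, G.degree v = n - 1 := by
    intro v
    obtain rfl := SimpleGraph.diam_eq_one.1 hd
    convert SimpleGraph.complete_graph_degree v
    simp
  rw [numGt_natAdj hadj] at hh ⊢
  simp only [hdeg] at hh ⊢
  by_cases e : h + 1 ≤ n - 1
  · simp [e] at hh
    omega
  · simp [e]

theorem two_rpow_logb {d h : ℕ} (hd : 1 ≤ d) (hh : 1 ≤ h) :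
    (2 : ℝ) ^ ((h : ℝ) * Real.logb 2 d + (d : ℝ) * Real.logb 2 h) =
      (d : ℝ) ^ h * (h : ℝ) ^ d := by
  have hd' : (0 : ℝ) < d := by exact_mod_cast hd
  have hh' : (0 : ℝ) < h := by exact_mod_cast hh
  rw [Real.rpow_add two_pos, mul_comm (h : ℝ), mul_comm (d : ℝ), Real.rpow_mul two_pos.le,
    Real.rpow_mul two_pos.le, Real.rpow_logb two_pos (by norm_num) hd',
    Real.rpow_logb two_pos (by norm_num) hh', Real.rpow_natCast, Real.rpow_natCast]

/-! ### The input string -/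

theorem length_flatMap_range (g : ℕ → List ℕ) (n : ℕ) :
    ((List.range n).flatMap g).length = ∑ u ∈ Finset.range n, (g u).length := by
  induction n with
  | zero => simp
  | succ v ih => simp [List.range_succ, Finset.sum_range_succ, ih]

theorem getD_flatMap_range (g : ℕ → List ℕ) {n v j : ℕ} (hv : v < n) (hj : j < (g v).length) :
    ((List.range n).flatMap g).getD (∑ u ∈ Finset.range v, (g u).length + j) 0 = (g v)[j] := by
  induction n with
  | zero => omega
  | succ n ih =>
    rw [List.range_succ, List.flatMap_append]
    by_cases e : v = n
    · subst e
      rw [List.getD_append_right _ _ _ _ (by rw [length_flatMap_range]; omega),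
        length_flatMap_range]
      simp [hj]
    · have h1 := ih (by omega)
      have h2 : ∑ u ∈ Finset.range (v + 1), (g u).length ≤ ∑ u ∈ Finset.range n, (g u).length :=
        Finset.sum_le_sum_of_subset (Finset.range_mono (by omega))
      rw [Finset.sum_range_succ] at h2
      rw [List.getD_append _ _ _ _ (by rw [length_flatMap_range]; omega), h1]

theorem encodeAdjList_eq (adj : Fin n → List (Fin n)) :
    encodeAdjList adj =
      n :: (List.range n).flatMap fun v => (natAdj adj v).length :: natAdj adj v := by
  rw [encodeAdjList, ← List.map_coe_finRange_eq_range, List.flatMap_map]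
  simp [natAdj_val]

theorem getD_encodeAdjList_len (adj : Fin n → List (Fin n)) {v : ℕ} (hv : v < n) :
    (encodeAdjList adj).getD (off (natAdj adj) v) 0 = (natAdj adj v).length := by
  have := getD_flatMap_range (fun v => (natAdj adj v).length :: natAdj adj v) hv (j := 0) (by simp)
  rw [encodeAdjList_eq, off, Nat.add_comm 1, List.getD_cons_succ]
  simpa using this

theorem getD_encodeAdjList_nbr (adj : Fin n → List (Fin n)) {v : ℕ} (hv : v < n) {j : ℕ}
    (hj : j < (natAdj adj v).length) :
    (encodeAdjList adj).getD (off (natAdj adj) v + 1 + j) 0 = (natAdj adj v)[j] := by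
  have := getD_flatMap_range (fun v => (natAdj adj v).length :: natAdj adj v) hv (j := j + 1)
    (by simpa using hj)
  rw [encodeAdjList_eq, off, show ∀ a, 1 + a + 1 + j = (a + (j + 1)) + 1 by intro a; omega,
    List.getD_cons_succ]
  simpa using this

theorem length_encodeAdjList (adj : Fin n → List (Fin n)) :
    (encodeAdjList adj).length = off (natAdj adj) n := by
  rw [encodeAdjList_eq, List.length_cons, length_flatMap_range, off, Nat.add_comm]
  simp

end

end WordRAM

/-! ### The main theorem -/

open WordRAM

theorem mainTheorem3 :
    ∃ (P : WordRAM.Prog) (k : ℕ) (C : ℝ),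
      ∀ (n : ℕ) (G : SimpleGraph (Fin n)) [DecidableRel G.Adj] (adj : Fin n → List (Fin n)),
        G.Connected → IsAdjList G adj →
        ∀ w : ℕ, (n + G.edgeFinset.card + 2) ^ k ≤ 2 ^ w →
          ∃ (s : WordRAM.State) (t : ℕ),
            WordRAM.Exec w P (WordRAM.initState (encodeAdjList adj)) s t ∧
            s.reg 0 = G.diam ∧
            (t : ℝ) ≤ C * max 1
              ((G.hIndex : ℝ) * ((G.edgeFinset.card : ℝ) + n) +
                n * G.diam *
                  (2 : ℝ) ^ ((G.hIndex : ℝ) * Real.logb 2 G.diam +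
                    (G.diam : ℝ) * Real.logb 2 G.hIndex)) := by
  -- Addresses stay below `zone U (3 * n) = (5 + 9 * n) * (n + 1) ^ 2`, which is at most `9 * (n +
  -- 2) ^ 3` and hence below `(n + 2) ^ 6`.
  refine ⟨diamProg, 6, 1000, fun n G _ adj hG hadj w hw => ?_⟩
  obtain ⟨v₀⟩ := hG.nonempty
  have hn : 0 < n := v₀.pos
  set m := G.edgeFinset.card
  have hzone : zone ((n + 1) * (n + 1)) (3 * n) < 2 ^ w := by
    refine lt_of_lt_of_le ?_ hw
    have h1 : n + 2 ≤ n + m + 2 := by omega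
    refine lt_of_lt_of_le ?_ (Nat.pow_le_pow_left h1 6)
    have h2 : zone ((n + 1) * (n + 1)) (3 * n) ≤ 9 * (n + 2) ^ 3 := by
      unfold zone
      nlinarith
    have h3 : 9 ≤ (n + 2) ^ 2 := by nlinarith
    have h4 : 0 < (n + 2) ^ 3 := by positivity
    calc _ ≤ 9 * (n + 2) ^ 3 := h2
      _ ≤ (n + 2) ^ 2 * (n + 2) ^ 3 := Nat.mul_le_mul_right _ h3
      _ < (n + 2) ^ 2 * (n + 2) ^ 3 * (n + 2) := by
        nlinarith [Nat.mul_pos (show 0 < (n + 2) ^ 2 by positivity) h4]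
      _ = (n + 2) ^ 6 := by ring
  have : Nonempty (Fin n) := ⟨v₀⟩
  have hne : G.ediam ≠ ⊤ := SimpleGraph.connected_iff_ediam_ne_top.1 hG
  have hdd : ∀ u < n, ∀ v < n, natDist G u v ≤ G.diam := fun u hu v hv => by
    have := natDist_val G ⟨u, hu⟩ ⟨v, hv⟩
    dsimp only at this
    rw [this]
    exact SimpleGraph.dist_le_diam hne
  obtain ⟨a, b, hab⟩ := G.exists_dist_eq_diam
  have hInp := isInput_natAdj hadj
  have hD := isDist_natDist hG hadj
  obtain ⟨s, t, hexec, hres, h, K, hh1, hh2, hK, ht⟩ := wp_diamProg (w := w)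
    (s := initState (encodeAdjList adj)) (d := G.diam) hn hInp rfl hzone
    rfl (by simp [initState, encodeAdjList]) (fun v hv => getD_encodeAdjList_len adj hv)
    (fun v hv j hj => getD_encodeAdjList_nbr adj hv hj)
    (fun x hx => List.getD_eq_default _ _ (by
      rw [length_encodeAdjList]; exact hInp.off_le.trans hx))
    hD hdd ⟨a, a.2, b, b.2, by rw [natDist_val, hab]⟩
  refine ⟨s, t, hexec, hres, ?_⟩
  rw [sum_length_natAdj hadj, Nat.zero_add] at ht
  obtain rfl := eq_hIndex hadj hh1 hh2
  have hdn : G.diam < n := by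
    rw [← hab, ← natDist_val]
    exact hD.lt a a.2 b b.2
  have hC : (1 : ℝ) ≤ max 1 ((G.hIndex : ℝ) * ((m : ℝ) + n) + n * G.diam *
      (2 : ℝ) ^ ((G.hIndex : ℝ) * Real.logb 2 G.diam + (G.diam : ℝ) * Real.logb 2 G.hIndex)) :=
    le_max_left _ _
  by_cases hn1 : n = 1
  -- For one vertex, `d = h = 0` and the running time is a constant, compared with the `1` in the
  -- maximum.
  · have hh0 : G.hIndex = 0 := by
      by_contra h0
      have h1 := hh2 0 (Nat.pos_of_ne_zero h0)
      rw [numGt_natAdj hadj, Finset.card_pos] at h1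
      obtain ⟨v, hv⟩ := h1
      have h2 := G.degree_lt_card_verts v
      simp only [Finset.mem_filter, Fintype.card_fin] at hv h2
      omega
    have hd0 : G.diam = 0 := by omega
    have hg0 : numGt n (natAdj adj) G.hIndex = 0 := by omega
    rw [hg0, hd0] at hK ht
    -- `m` depends on `n` through `G`; hiding it allows `n` to be rewritten to `1`, and its value is
    -- irrelevant because its factor `g` is `0`.
    generalize 2 * m = M at ht
    rw [hh0, hn1] at ht
    have ht' : t ≤ 1000 := by
      simp [diamTime] at ht hK
      omega
    have ht'' : (t : ℝ) ≤ 1000 := by exact_mod_cast ht'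
    linarith
  · have : Nontrivial (Fin n) := Fin.nontrivial_iff_two_le.2 (by omega)
    have hd1 : 1 ≤ G.diam := Nat.pos_of_ne_zero (SimpleGraph.diam_ne_zero_of_ediam_ne_top hne)
    have hh0 : 1 ≤ G.hIndex := by
      by_contra h0
      rw [show G.hIndex = 0 by omega, numGt_natAdj hadj, Nat.le_zero, Finset.card_eq_zero,
        Finset.filter_eq_empty_iff] at hh1
      exact hh1 (Finset.mem_univ v₀) (hG.preconnected.degree_pos_of_nontrivial v₀)
    have hb := diamTime_le (m := m) hn hdn.le hd1 hh0 hh1 hK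
      fun h => numGt_eq_zero_of_diam_eq_one hadj h hh1
    have hpow := two_rpow_logb hd1 hh0
    have ht' : (t : ℝ) ≤ 400 * (G.hIndex * (m + n) + n * G.diam *
        ((G.diam : ℝ) ^ G.hIndex * (G.hIndex : ℝ) ^ G.diam)) := by
      exact_mod_cast ht.trans hb
    rw [← hpow] at ht'
    have := le_max_right 1 ((G.hIndex : ℝ) * ((m : ℝ) + n) + n * G.diam *
      (2 : ℝ) ^ ((G.hIndex : ℝ) * Real.logb 2 G.diam + (G.diam : ℝ) * Real.logb 2 G.hIndex))
    linarith
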